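/- **Notation.** For a formal power series $h$, $\bar h$ is the series with complex-conjugated coefficients. A *formal real hypersurface* $M\subset\mathbb C^N$ (through $0$) is given by a series $r(Z,\zeta)\in\mathbb C[[Z,\zeta]]$, $Z,\zeta\in\mathbb C^N$, with $\bar r(\zeta,Z)=r(Z,\zeta)$, $r(0)=0$ and $\partial_Z r(0)\neq 0$; $\mathcal I(M)$ is the ideal generated by $r$, and $T^{1,0}_0M=\ker \partial_Z r(0)\subset T_0\mathbb C^N$. *Normal coordinates* for $M$ are formal coordinates $Z=Z(z,w)$, $(z,w)\in\mathbb C^{N-1}\times\mathbb C$, such that in the coordinates $((z,w),(\chi,\tau))$, $(Z,\zeta)=(Z(z,w),\bar Z(\chi,\tau))$, the ideal $\mathcal I(M)$ is generated by $w-Q(z,\chi,\tau)$, where $Q(0,\chi,\tau)=Q(z,0,\tau)=\tau$. The *generic rank* of a formal map is the rank of its Jacobian matrix over the ring of formal power series. $M$ is of *finite type* if $Q(z,\chi,0)\not\equiv0$, and *belongs to the class $\mathcal C$* if for $k$ large enough the map $\chi\mapsto (Q_{z^\alpha}(0,\chi,0))_{|\alpha|\le k}$ has generic rank $N-1$; both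 conditions are independent of the choice of normal coordinates. A formal holomorphic map $H\colon(\mathbb C^N,0)\to(\mathbb C^N,0)$ *sends $M$ into $M'$* if $h(H(Z),\bar H(\zeta))\in\mathcal I(M)$ for all $h\in\mathcal I(M')$. It is *CR-transversal* if $T^{1,0}_0M'+dH(T_0\mathbb C^N)=T_0\mathbb C^N$. Writing $H=(F,G)\in\mathbb C^{N-1}\times\mathbb C$ in normal coordinates for $M$ and $M'$, $H$ is *transversally flat* if $G\equiv0$, and *not totally degenerate* if the matrix $\frac{\partial F}{\partial z}(z,0)$ has generic rank $N-1$. **Proposition.** Let $N\ge2$, let $M,M'\subset\mathbb C^N$ be formal real hypersurfaces with $M$ in the class $\mathcal C$, and let $H\colon(\mathbb C^N,0)\to(\mathbb C^N,0)$ be a formal holomorphic map sending $M$ into $M'$. Consider, with respect to any choice of normal coordinates for $M$ and $M'$, the conditions (i) $H$ is CR-transversal; (ii) $H$ is not totally degenerate. Then (i) implies (ii). If moreover $M'$ is of finite type or $H$ is not transversally flat, then (i) and (ii) are equivalent. -/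

import Mathlib

open MvPowerSeries

noncomputable section

namespace FormalCR

/-- Complex conjugation of the coefficients of a formal power series, `h ↦ h̄`. -/
def conjSeries {σ : Type*} (h : MvPowerSeries σ ℂ) : MvPowerSeries σ ℂ :=
  MvPowerSeries.map (starRingEnd ℂ) h

/-- A formal holomorphic map `(ℂ^N, 0) → (ℂ^N, 0)`: `N` formal power series in `N` variables
without constant term. -/
structure FormalMap (N : ℕ) where
  toFun : Fin N → MvPowerSeries (Fin N) ℂ
  zero : ∀ i, constantCoeff (toFun i) = 0

namespace FormalMap

variable {N : ℕ}

/-- The complexification `(Z, ζ) ↦ (H(Z), H̄(ζ))` of a formal holomorphic map `H`.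
The variables `Z` are indexed by `Sum.inl` and the variables `ζ` by `Sum.inr`. -/
def complexify (H : FormalMap N) : Fin N ⊕ Fin N → MvPowerSeries (Fin N ⊕ Fin N) ℂ :=
  Sum.elim
    (fun i => subst (fun j => (X (Sum.inl j) : MvPowerSeries (Fin N ⊕ Fin N) ℂ)) (H.toFun i))
    (fun i => subst (fun j => (X (Sum.inr j) : MvPowerSeries (Fin N ⊕ Fin N) ℂ))
      (conjSeries (H.toFun i)))

/-- The components of the composition `K ∘ H`. -/
def compFun (K H : FormalMap N) : Fin N → MvPowerSeries (Fin N) ℂ :=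
  fun i => subst H.toFun (K.toFun i)

/-- The differential of `H` at the origin. -/
def differential (H : FormalMap N) : (Fin N → ℂ) →ₗ[ℂ] (Fin N → ℂ) :=
  Matrix.toLin' (Matrix.of fun i j => coeff (Finsupp.single j 1) (H.toFun i))

end FormalMap

/-- A formal change of coordinates of `(ℂ^N, 0)`: a formal map together with its
(necessarily unique) inverse under composition. -/
structure FormalCoordChange (N : ℕ) where
  map : FormalMap N
  inv : FormalMap N
  map_inv : map.compFun inv = fun i => X i
  inv_map : inv.compFun map = fun i => X i

/-- The involution `σ(f)(Z, ζ) = f̄(ζ, Z)` of `ℂ[[Z, ζ]]`. -/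
def involution {N : ℕ} (f : MvPowerSeries (Fin N ⊕ Fin N) ℂ) :
    MvPowerSeries (Fin N ⊕ Fin N) ℂ :=
  subst (fun k => (X k.swap : MvPowerSeries (Fin N ⊕ Fin N) ℂ)) (conjSeries f)

/-- A formal real hypersurface through the origin of `ℂ^N`, given by a defining power series
`r(Z, ζ)`: invariant under the involution, vanishing at `0`, and with non-vanishing gradient
with respect to `Z` at `0`. -/
structure FormalHypersurface (N : ℕ) where
  r : MvPowerSeries (Fin N ⊕ Fin N) ℂ
  invariant : involution r = r
  zero : constantCoeff r = 0
  gradient : ∃ j : Fin N, coeff (Finsupp.single (Sum.inl j) 1) r ≠ 0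

namespace FormalHypersurface

variable {N : ℕ}

/-- The ideal `I(M)` generated by the defining power series. -/
def ideal (M : FormalHypersurface N) : Ideal (MvPowerSeries (Fin N ⊕ Fin N) ℂ) :=
  Ideal.span {M.r}

/-- The complex linear form `∂_Z r(0)` on `T_0 ℂ^N = ℂ^N`. -/
def gradientForm (M : FormalHypersurface N) : (Fin N → ℂ) →ₗ[ℂ] ℂ :=
  ∑ j, coeff (Finsupp.single (Sum.inl j) 1) M.r • LinearMap.proj j

/-- The space `T_0^{1,0} M`. -/
def tangent10 (M : FormalHypersurface N) : Submodule ℂ (Fin N → ℂ) :=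
  LinearMap.ker M.gradientForm

end FormalHypersurface

/-- `H` sends `M` into `M'`: the ideal `I(M')` is contained in the pushforward of `I(M)` under
the complexification of `H`. -/
def SendsInto {N : ℕ} (H : FormalMap N) (M M' : FormalHypersurface N) : Prop :=
  ∀ h ∈ M'.ideal, subst H.complexify h ∈ M.ideal

/-- `H`, as a map into `M'`, is CR-transversal: `T_0^{1,0} M' + dH(T_0 ℂ^N) = T_0 ℂ^N`. -/
def CRTransversal {N : ℕ} (H : FormalMap N) (M' : FormalHypersurface N) : Prop :=
  M'.tangent10 ⊔ LinearMap.range H.differential = ⊤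

/-- The power series `w - Q(z, χ, τ)` in the variables `((z, w), (χ, τ))`. In `ℂ^{n+1}` the first
`n` coordinates are `z` (resp. `χ`) and the last one is `w` (resp. `τ`). The variables of `Q` are
`z`, indexed by `Fin n`, and `(χ, τ)`, indexed by `Fin (n + 1)`. -/
def graphSeries {n : ℕ} (Q : MvPowerSeries (Fin n ⊕ Fin (n + 1)) ℂ) :
    MvPowerSeries (Fin (n + 1) ⊕ Fin (n + 1)) ℂ :=
  X (Sum.inl (Fin.last n)) -
    subst (fun k => (X (Sum.map Fin.castSucc id k) :
      MvPowerSeries (Fin (n + 1) ⊕ Fin (n + 1)) ℂ)) Q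

/-- Normal coordinates `(z, w)` for a formal real hypersurface `M` of `ℂ^{n+1}`: a formal change
of coordinates `Z = Z(z, w)` such that, in the coordinates `((z, w), (χ, τ))`, the hypersurface
`M` is defined by `w = Q(z, χ, τ)` with `Q(0, χ, τ) = Q(z, 0, τ) = τ`. -/
structure NormalCoordinates {n : ℕ} (M : FormalHypersurface (n + 1)) where
  change : FormalCoordChange (n + 1)
  Q : MvPowerSeries (Fin n ⊕ Fin (n + 1)) ℂ
  defines : Ideal.span {subst change.map.complexify M.r} = Ideal.span {graphSeries Q}
  normal_z : subst (Sum.elim (fun _ : Fin n => 0) (fun j => X (Sum.inr j)) :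
      Fin n ⊕ Fin (n + 1) → MvPowerSeries (Fin n ⊕ Fin (n + 1)) ℂ) Q =
    X (Sum.inr (Fin.last n))
  normal_chi : subst (Sum.elim (fun i => X (Sum.inl i))
      (Fin.lastCases (X (Sum.inr (Fin.last n))) (fun _ : Fin n => 0)) :
      Fin n ⊕ Fin (n + 1) → MvPowerSeries (Fin n ⊕ Fin (n + 1)) ℂ) Q =
    X (Sum.inr (Fin.last n))

/-- The generic rank of a formal map `F` in finitely many variables: the rank of its Jacobian
matrix over the ring of formal power series. -/
def genericRank {ι σ : Type*} [Fintype σ] (F : ι → MvPowerSeries σ ℂ) : ℕ :=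
  (Matrix.of fun i j => pderiv ℂ j (F i)).rank

namespace NormalCoordinates

variable {n : ℕ} {M M' : FormalHypersurface (n + 1)}

/-- The power series `Q_{z^α}(0, χ, 0)` in `χ`: if `Q = ∑ q_{α,β,k} z^α χ^β τ^k`, it is
`∑_β α! q_{α,β,0} χ^β`. -/
def zDeriv (c : NormalCoordinates M) (α : Fin n →₀ ℕ) : MvPowerSeries (Fin n) ℂ :=
  fun β => ((∏ i, (α i).factorial : ℕ) : ℂ) *
    coeff (Finsupp.sumElim α (Finsupp.mapDomain Fin.castSucc β)) c.Q

/-- For `k` large enough, the map `χ ↦ (Q_{z^α}(0, χ, 0))_{|α| ≤ k}` is of generic rank `n`. -/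
def ClassC (c : NormalCoordinates M) : Prop :=
  ∀ᶠ k : ℕ in Filter.atTop,
    genericRank (fun α : {α : Fin n →₀ ℕ // α.degree ≤ k} => c.zDeriv α) = n

/-- `Q(z, χ, 0) ≢ 0`. -/
def FiniteType (c : NormalCoordinates M) : Prop :=
  subst (Sum.elim (fun i => X (Sum.inl i))
    (Fin.lastCases 0 (fun i : Fin n => X (Sum.inr i))) :
    Fin n ⊕ Fin (n + 1) → MvPowerSeries (Fin n ⊕ Fin n) ℂ) c.Q ≠ 0

/-- The components `(F, G)` of the formal map `H` when normal coordinates `c` for `M` and `c'`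
for `M'` are used in the source and in the target. -/
def express (c : NormalCoordinates M) (c' : NormalCoordinates M') (H : FormalMap (n + 1)) :
    Fin (n + 1) → MvPowerSeries (Fin (n + 1)) ℂ :=
  fun i => subst c.change.map.toFun (subst H.toFun (c'.change.inv.toFun i))

/-- `H = (F, G)` is transversally flat: `G ≡ 0`. -/
def TransversallyFlat (c : NormalCoordinates M) (c' : NormalCoordinates M')
    (H : FormalMap (n + 1)) : Prop :=
  express c c' H (Fin.last n) = 0

/-- `H = (F, G)` is not totally degenerate: the matrix `∂F/∂z (z, 0)` is of generic rank `n`. -/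
def NotTotallyDegenerate (c : NormalCoordinates M) (c' : NormalCoordinates M')
    (H : FormalMap (n + 1)) : Prop :=
  (Matrix.of fun i j : Fin n =>
    subst (Fin.lastCases 0 (fun l : Fin n => X l) : Fin (n + 1) → MvPowerSeries (Fin n) ℂ)
      (pderiv ℂ j.castSucc (express c c' H i.castSucc))).rank = n

end NormalCoordinates

namespace FormalHypersurface

variable {n : ℕ}

/-- `M` belongs to the class `𝒞`. (The condition does not depend on the normal coordinates.) -/
def InClassC (M : FormalHypersurface (n + 1)) : Prop :=
  ∃ c : NormalCoordinates M, c.ClassC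

/-- `M` is of finite type. (The condition does not depend on the normal coordinates.) -/
def IsFiniteType (M : FormalHypersurface (n + 1)) : Prop :=
  ∃ c : NormalCoordinates M, c.FiniteType

end FormalHypersurface

end FormalCR

end

/-! Write `H = (F, G)` in normal coordinates; mapping `M` into `M'` then means `G(z, Q) = Q'(F(z,
Q), H̄(χ, τ))` (`isNormalMap`). At `χ = τ = 0` this gives `G(z, 0) = 0`, so CR-transversality
becomes `G_w(0) ≠ 0` (`crTransversal_iff`). Let `u = G_w - ∑ Q'_{z_i} F_{i,w}` along the graph.
Differentiating in `ζ = (χ, τ)` gives `u Q_{ζ_j} = ∑ Q'_{ζ_k} ∂_j H̄_k`, where `u(z, 0, 0) = G_w(z,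
0)`.

(i) ⇒ (ii), `det_restrictedJacobian_ne_zero`: at `τ = 0` the term with `Ḡ` drops. A kernel vector
`v(χ)` of the conjugate of `∂F/∂z(·, 0)` then satisfies `∑ Q_{χ_j}(z, χ, 0) v_j(χ) = 0`, because `u
≠ 0` in a domain. Comparing coefficients of `z^α`, the class `𝒞` forces `v = 0`.

(ii) ⇒ (i), `constantCoeff_pderiv_last_ne_zero_of_finiteType`: Cramer's rule yields `u E = det
H̄_ζ(ζ) · unit` (`exists_transversalFactor_mul`). If `G_w(z, 0) ≠ 0`, then `det H̄_ζ ≠ 0`, and a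
divisor `u` of a nonzero series in `ζ` alone with `u(z, 0) ≠ 0` is a unit, so `G_w(0) ≠ 0`. If
`G_w(z, 0) = 0`, then `u` vanishes at `τ = 0`, and hence so does `Q'_{χ'}(F(z, Q), F̄(χ, 0), 0)`.
The substitution has full generic rank, so `Q'(z', χ', 0) = 0` and `M'` is not of finite type. Then
also `G(z, Q(z, χ, 0)) = 0`, and `G = 0` because `M`, being in `𝒞`, is of finite type.

Class `𝒞` and finite type are given in some normal coordinates, so nondegeneracy and finite type are
also carried from one choice to another. -/

noncomputable section

namespace FormalCR

/-! ### Formal power series: chain rule and injectivity of substitutions. -/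

section PowerSeries

variable {σ τ R : Type*} [CommRing R]

theorem constantCoeff_subst_of_zero {a : σ → MvPowerSeries τ R} (ha : HasSubst a)
    (h0 : ∀ i, constantCoeff (a i) = 0) (f : MvPowerSeries σ R) :
    constantCoeff (subst a f) = constantCoeff f := by
  have h := constantCoeff_subst_eq_zero ha h0 (f := f - C (constantCoeff f)) (by simp)
  rw [subst_sub ha, subst_C, map_sub, sub_eq_zero] at h
  simpa using h

open MvPowerSeries.WithPiTopology in
theorem continuous_pderiv [TopologicalSpace R] [IsTopologicalRing R] (i : σ) :
    Continuous (pderiv R i : MvPowerSeries σ R → MvPowerSeries σ R) := by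
  refine continuous_pi fun d => ?_
  have : (fun f : MvPowerSeries σ R => pderiv R i f d) =
      fun f => coeff (d + Finsupp.single i 1) f * ((d i : R) + 1) :=
    funext fun f => coeff_pderiv f d
  rw [this]
  exact (continuous_coeff R _).mul continuous_const

open MvPowerSeries.WithPiTopology in
/-- The chain rule for formal power series. -/
theorem pderiv_subst [Fintype σ] {a : σ → MvPowerSeries τ R} (ha : HasSubst a)
    (f : MvPowerSeries σ R) (j : τ) :
    pderiv R j (subst a f) = ∑ i, subst a (pderiv R i f) * pderiv R j (a i) := by
  classical
  -- For discrete `R` both sides are continuous in `f` and polynomials are dense, so the polynomial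
  -- case suffices.
  let _ : UniformSpace R := ⊥
  have : DiscreteUniformity R := ⟨rfl⟩
  have h1 : Continuous fun f : MvPowerSeries σ R => pderiv R j (subst a f) :=
    (continuous_pderiv j).comp (continuous_subst ha)
  have h2 : Continuous fun f : MvPowerSeries σ R =>
      ∑ i, subst a (pderiv R i f) * pderiv R j (a i) :=
    continuous_finsetSum _ fun i _ =>
      ((continuous_subst ha).comp (continuous_pderiv i)).mul continuous_const
  refine congrFun (denseRange_toMvPowerSeries.equalizer h1 h2 ?_) f
  funext p
  simp only [Function.comp, subst_coe, pderiv_coe]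
  induction p using MvPolynomial.induction_on with
  | C r =>
    simp [MvPowerSeries.algebraMap_apply]
  | add p q hp hq => simp [hp, hq, add_mul, Finset.sum_add_distrib]
  | mul_X p i hp =>
    simp only [map_mul, MvPolynomial.aeval_X, Derivation.leibniz, smul_eq_mul, map_add, hp,
      add_mul, Finset.sum_add_distrib, MvPolynomial.pderiv_X, Finset.mul_sum]
    congr 1
    · rw [Finset.sum_eq_single i]
      · simp
      · intro b _ hb
        simp [Pi.single_eq_of_ne' hb]
      · simp
    · exact Finset.sum_congr rfl fun k _ => by ring

theorem hasSubst_zero_coeff [Finite σ] {a : σ → MvPowerSeries τ R}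
    (h0 : ∀ i, constantCoeff (a i) = 0) : HasSubst a :=
  hasSubst_of_constantCoeff_zero h0

theorem coeff_single_eq_constantCoeff_pderiv (f : MvPowerSeries σ R) (i : σ) :
    coeff (Finsupp.single i 1) f = constantCoeff (pderiv R i f) := by
  rw [← coeff_zero_eq_constantCoeff_apply, coeff_pderiv]
  simp

/-- The linear part of a composition. -/
theorem coeff_single_subst [Fintype σ] {a : σ → MvPowerSeries τ R}
    (h0 : ∀ i, constantCoeff (a i) = 0) (f : MvPowerSeries σ R) (j : τ) :
    coeff (Finsupp.single j 1) (subst a f) =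
      ∑ i, coeff (Finsupp.single i 1) f * coeff (Finsupp.single j 1) (a i) := by
  have ha : HasSubst a := hasSubst_of_constantCoeff_zero h0
  simp only [coeff_single_eq_constantCoeff_pderiv, pderiv_subst ha, map_sum, map_mul,
    constantCoeff_subst_of_zero ha h0]

theorem pderiv_map {S : Type*} [CommRing S] (φ : R →+* S) (f : MvPowerSeries σ R) (i : σ) :
    pderiv S i (MvPowerSeries.map φ f) = MvPowerSeries.map φ (pderiv R i f) := by
  ext d
  simp [coeff_pderiv, coeff_map]

/-- Coefficients of a series in which some of the variables are set to zero. -/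
theorem coeff_subst_of_partialInv {a : σ → MvPowerSeries τ R} (ha : HasSubst a) (ι : τ → σ)
    (hι : Function.Injective ι) (hX : ∀ t, a (ι t) = X t) (h0 : ∀ s, s ∉ Set.range ι → a s = 0)
    (f : MvPowerSeries σ R) (d : τ →₀ ℕ) :
    coeff d (subst a f) = coeff (Finsupp.mapDomain ι d) f := by
  classical
  have key : ∀ e : τ →₀ ℕ, ((Finsupp.mapDomain ι e).prod fun s n => a s ^ n) =
      monomial e (1 : R) := by
    intro e
    rw [Finsupp.prod_mapDomain_index_inj hι, monomial_one_eq]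
    exact Finsupp.prod_congr fun t _ => by rw [hX]
  rw [coeff_subst ha, finsum_eq_single _ (Finsupp.mapDomain ι d)]
  · rw [key, coeff_monomial_same, smul_eq_mul, mul_one]
  · intro e he
    by_cases hs : ∀ s ∈ e.support, s ∈ Set.range ι
    · have hee : Finsupp.mapDomain ι (Finsupp.comapDomain ι e hι.injOn) = e :=
        Finsupp.mapDomain_comapDomain ι hι e (fun s hs' => hs s hs')
      have hne : d ≠ Finsupp.comapDomain ι e hι.injOn := by
        rintro rfl
        exact he hee.symm
      rw [← hee, key, coeff_monomial_ne hne, smul_zero]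
    · push Not at hs
      obtain ⟨s, hs, hs'⟩ := hs
      rw [Finsupp.prod, Finset.prod_eq_zero hs, map_zero, smul_zero]
      rw [h0 s hs', zero_pow (Finsupp.mem_support_iff.mp hs)]

theorem coeff_eq_zero_of_pderiv_eq_zero [CharZero R] [NoZeroDivisors R] {f : MvPowerSeries σ R}
    {s : σ} (h : pderiv R s f = 0) {d : σ →₀ ℕ} (hd : d s ≠ 0) : coeff d f = 0 := by
  have hle : Finsupp.single s 1 ≤ d := by
    rw [Finsupp.single_le_iff]
    exact Nat.one_le_iff_ne_zero.mpr hd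
  have := congrArg (coeff (d - Finsupp.single s 1)) h
  rw [coeff_pderiv, tsub_add_cancel_of_le hle, map_zero] at this
  refine (mul_eq_zero.mp this).resolve_right ?_
  exact Nat.cast_add_one_ne_zero _

/-- Coefficients supported on the range of `ι` are visible after the substitution; any other
exponent involves a variable in which the derivative of `f` vanishes. -/
theorem eq_zero_of_pderiv_eq_zero_of_subst [CharZero R] [NoZeroDivisors R]
    {a : σ → MvPowerSeries τ R} (ha : HasSubst a) (ι : τ → σ)
    (hι : Function.Injective ι) (hX : ∀ t, a (ι t) = X t) (h0 : ∀ s, s ∉ Set.range ι → a s = 0)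
    {f : MvPowerSeries σ R} (hf : subst a f = 0)
    (hd : ∀ s, s ∉ Set.range ι → pderiv R s f = 0) : f = 0 := by
  classical
  ext e
  rw [map_zero]
  by_cases hs : ∀ s ∈ e.support, s ∈ Set.range ι
  · have hee : Finsupp.mapDomain ι (Finsupp.comapDomain ι e hι.injOn) = e :=
      Finsupp.mapDomain_comapDomain ι hι e (fun s hs' => hs s hs')
    rw [← hee, ← coeff_subst_of_partialInv ha ι hι hX h0, hf, map_zero]
  · push Not at hs
    obtain ⟨s, hs, hs'⟩ := hs
    exact coeff_eq_zero_of_pderiv_eq_zero (hd s hs') (Finsupp.mem_support_iff.mp hs)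

/-- A substitution of maximal generic rank is injective. -/
theorem eq_zero_of_subst_eq_zero [CharZero R] [NoZeroDivisors R] [Fintype σ]
    {a : σ → MvPowerSeries τ R}
    (h0 : ∀ i, constantCoeff (a i) = 0)
    (hrank : ∀ v : σ → MvPowerSeries τ R, (∀ j, ∑ i, v i * pderiv R j (a i) = 0) → v = 0)
    {f : MvPowerSeries σ R} (hf : subst a f = 0) : f = 0 := by
  have ha : HasSubst a := hasSubst_of_constantCoeff_zero h0
  suffices h : ∀ (m : ℕ) (f : MvPowerSeries σ R), subst a f = 0 →
      ∀ d : σ →₀ ℕ, d.degree = m → coeff d f = 0 by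
    ext d
    exact h _ f hf d rfl
  intro m
  induction m with
  | zero =>
    intro f hf d hd
    rw [(Finsupp.degree_eq_zero_iff d).mp hd, coeff_zero_eq_constantCoeff_apply,
      ← constantCoeff_subst_of_zero ha h0, hf, map_zero]
  | succ m ih =>
    intro f hf d hd
    -- By the chain rule the substituted partials of `f` form a relation between the rows of the
    -- Jacobian of `a`, so each is zero and the induction applies to the partials.
    have hv : (fun i => subst a (pderiv R i f)) = 0 := by
      refine hrank _ fun j => ?_
      rw [← pderiv_subst ha, hf, map_zero]
    have hd0 : d ≠ 0 := by
      rintro rfl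
      simp at hd
    obtain ⟨i, hi⟩ := Finsupp.ne_iff.mp hd0
    have hle : Finsupp.single i 1 ≤ d := by
      rw [Finsupp.single_le_iff]
      exact Nat.one_le_iff_ne_zero.mpr hi
    have := ih (pderiv R i f) (congrFun hv i) (d - Finsupp.single i 1) (by
      have h2 := congrArg Finsupp.degree (tsub_add_cancel_of_le hle)
      rw [map_add, Finsupp.degree_single] at h2
      omega)
    rw [coeff_pderiv, tsub_add_cancel_of_le hle] at this
    refine (mul_eq_zero.mp this).resolve_right ?_
    exact Nat.cast_add_one_ne_zero _

end PowerSeries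

/-! ### Full rank of matrices over a domain. -/

section Rank

variable {R ι : Type} [CommRing R] [IsDomain R] {n : ℕ}

/-- Rank-nullity, in cardinals because there may be infinitely many rows; both ranks are bounded by
`n`, and a torsion-free kernel of rank zero is trivial. -/
theorem rank_eq_card_iff_injective (A : Matrix ι (Fin n) R) :
    A.rank = n ↔ ∀ v, A.mulVec v = 0 → v = 0 := by
  have hrn := LinearMap.rank_range_add_rank_ker A.mulVecLin
  rw [rank_fin_fun] at hrn
  have hker : (∀ v, A.mulVec v = 0 → v = 0) ↔ LinearMap.ker A.mulVecLin = ⊥ := by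
    rw [LinearMap.ker_eq_bot']
    rfl
  rw [hker, Matrix.rank, Module.finrank, ← Submodule.rank_eq_zero]
  have h1 : Module.rank R (LinearMap.range A.mulVecLin) < Cardinal.aleph0 :=
    (self_le_add_right _ _).trans_lt (hrn ▸ Cardinal.natCast_lt_aleph0)
  have h2 : Module.rank R (LinearMap.ker A.mulVecLin) < Cardinal.aleph0 :=
    (self_le_add_left _ _).trans_lt (hrn ▸ Cardinal.natCast_lt_aleph0)
  rw [← Cardinal.cast_toNat_of_lt_aleph0 h1, ← Cardinal.cast_toNat_of_lt_aleph0 h2] at hrn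
  have h3 : Module.rank R (LinearMap.ker A.mulVecLin) = 0 ↔
      Cardinal.toNat (Module.rank R (LinearMap.ker A.mulVecLin)) = 0 := by
    rw [Cardinal.toNat_eq_zero]
    simp [h2]
  rw [h3]
  have h4 : Cardinal.toNat (Module.rank R (LinearMap.range A.mulVecLin)) +
      Cardinal.toNat (Module.rank R (LinearMap.ker A.mulVecLin)) = n := by
    exact_mod_cast hrn
  omega

theorem rank_eq_card_iff_det_ne_zero (A : Matrix (Fin n) (Fin n) R) :
    A.rank = n ↔ A.det ≠ 0 := by
  rw [rank_eq_card_iff_injective, ← not_iff_not, not_not, ← Matrix.exists_mulVec_eq_zero_iff]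
  push Not
  exact exists_congr fun v => and_comm

theorem eq_zero_of_vecMul_eq_zero {A : Matrix (Fin n) (Fin n) R} (hA : A.det ≠ 0)
    {v : Fin n → R} (hv : ∀ j, ∑ i, v i * A i j = 0) : v = 0 := by
  by_contra h
  exact hA (Matrix.exists_vecMul_eq_zero_iff.mp ⟨v, h, funext hv⟩)

end Rank

/-! ### Restrictions to coordinate subspaces and the normalization of `Q`. -/

section

variable {n : ℕ}

/-- Restriction of `f(z, w)` to `w = 0`. -/
def wZero : Fin (n + 1) → MvPowerSeries (Fin n) ℂ :=
  Fin.lastCases 0 (fun l : Fin n => X l)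

/-- Restriction of `f(z, χ, τ)` to `χ = 0`, `τ = 0`. -/
def zetaZero : Fin n ⊕ Fin (n + 1) → MvPowerSeries (Fin n) ℂ :=
  Sum.elim (fun i => X i) (fun _ => 0)

/-- Restriction of `f(z, χ, τ)` to `τ = 0`. -/
def tauZero : Fin n ⊕ Fin (n + 1) → MvPowerSeries (Fin n ⊕ Fin n) ℂ :=
  Sum.elim (fun i => X (Sum.inl i)) (Fin.lastCases 0 (fun i : Fin n => X (Sum.inr i)))

/-- The variables `ζ = (χ, τ)` among `(z, χ, τ)`. -/
def zetaIncl : Fin (n + 1) → MvPowerSeries (Fin n ⊕ Fin (n + 1)) ℂ :=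
  fun j => X (Sum.inr j)

/-- Restriction of `f(z, χ, τ)` to `z = 0`. -/
def zZero : Fin n ⊕ Fin (n + 1) → MvPowerSeries (Fin n ⊕ Fin (n + 1)) ℂ :=
  Sum.elim (fun _ : Fin n => 0) (fun j => X (Sum.inr j))

/-- Restriction of `f(z, χ, τ)` to `χ = 0`. -/
def chiZero : Fin n ⊕ Fin (n + 1) → MvPowerSeries (Fin n ⊕ Fin (n + 1)) ℂ :=
  Sum.elim (fun i => X (Sum.inl i))
      (Fin.lastCases (X (Sum.inr (Fin.last n))) (fun _ : Fin n => 0))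

/-- The substitution `(z, w) = (z, Q(z, χ, τ))`. -/
def graphPt (Q : MvPowerSeries (Fin n ⊕ Fin (n + 1)) ℂ) :
    Fin (n + 1) → MvPowerSeries (Fin n ⊕ Fin (n + 1)) ℂ :=
  Fin.lastCases Q (fun i : Fin n => X (Sum.inl i))

/-- The substitution `(z', χ', τ') = (F(z, Q(z, χ, τ)), H̄(χ, τ))`, where `H = (F, G)`. -/
def mapPt (Q : MvPowerSeries (Fin n ⊕ Fin (n + 1)) ℂ)
    (K : Fin (n + 1) → MvPowerSeries (Fin (n + 1)) ℂ) :
    Fin n ⊕ Fin (n + 1) → MvPowerSeries (Fin n ⊕ Fin (n + 1)) ℂ :=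
  Sum.elim (fun i => subst (graphPt Q) (K i.castSucc))
    (fun j => subst zetaIncl (conjSeries (K j)))

/-- The normalization `Q(0, χ, τ) = Q(z, 0, τ) = τ`. -/
structure IsNormal (Q : MvPowerSeries (Fin n ⊕ Fin (n + 1)) ℂ) : Prop where
  normal_z : subst zZero Q = X (Sum.inr (Fin.last n))
  normal_chi : subst chiZero Q = X (Sum.inr (Fin.last n))

@[simp] theorem wZero_last : wZero (Fin.last n) = 0 := Fin.lastCases_last
@[simp] theorem wZero_castSucc (i : Fin n) : wZero i.castSucc = X i := Fin.lastCases_castSucc _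
@[simp] theorem zetaZero_inl (i : Fin n) : zetaZero (Sum.inl i) = X i := rfl
@[simp] theorem zetaZero_inr (i : Fin (n + 1)) : zetaZero (Sum.inr i) = 0 := rfl
@[simp] theorem tauZero_inl (i : Fin n) : tauZero (Sum.inl i) = X (Sum.inl i) := rfl
@[simp] theorem tauZero_inr_last : tauZero (Sum.inr (Fin.last n)) = 0 := by
  simp [tauZero]
@[simp] theorem tauZero_inr_castSucc (i : Fin n) :
    tauZero (Sum.inr i.castSucc) = X (Sum.inr i) := by
  simp [tauZero]
@[simp] theorem zetaIncl_apply (j : Fin (n + 1)) : zetaIncl j = X (Sum.inr j) := rfl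
@[simp] theorem zZero_inl (i : Fin n) : zZero (Sum.inl i) = 0 := rfl
@[simp] theorem zZero_inr (j : Fin (n + 1)) : zZero (Sum.inr j) = X (Sum.inr j) := rfl
@[simp] theorem chiZero_inl (i : Fin n) : chiZero (Sum.inl i) = X (Sum.inl i) := rfl
@[simp] theorem chiZero_inr_last :
    chiZero (Sum.inr (Fin.last n)) = X (Sum.inr (Fin.last n)) := by
  simp [chiZero]
@[simp] theorem chiZero_inr_castSucc (i : Fin n) : chiZero (Sum.inr i.castSucc) = 0 := by
  simp [chiZero]
@[simp] theorem graphPt_last (Q : MvPowerSeries (Fin n ⊕ Fin (n + 1)) ℂ) :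
    graphPt Q (Fin.last n) = Q := Fin.lastCases_last
@[simp] theorem graphPt_castSucc (Q : MvPowerSeries (Fin n ⊕ Fin (n + 1)) ℂ) (i : Fin n) :
    graphPt Q i.castSucc = X (Sum.inl i) := Fin.lastCases_castSucc _
@[simp] theorem mapPt_inl (Q : MvPowerSeries (Fin n ⊕ Fin (n + 1)) ℂ)
    (K : Fin (n + 1) → MvPowerSeries (Fin (n + 1)) ℂ) (i : Fin n) :
    mapPt Q K (Sum.inl i) = subst (graphPt Q) (K i.castSucc) := rfl
@[simp] theorem mapPt_inr (Q : MvPowerSeries (Fin n ⊕ Fin (n + 1)) ℂ)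
    (K : Fin (n + 1) → MvPowerSeries (Fin (n + 1)) ℂ) (j : Fin (n + 1)) :
    mapPt Q K (Sum.inr j) = subst zetaIncl (conjSeries (K j)) := rfl

theorem constantCoeff_wZero (i : Fin (n + 1)) : constantCoeff (wZero i) = 0 := by
  refine Fin.lastCases ?_ (fun i => ?_) i <;> simp

theorem constantCoeff_zetaZero (k : Fin n ⊕ Fin (n + 1)) : constantCoeff (zetaZero k) = 0 := by
  rcases k with i | j <;> simp

theorem constantCoeff_tauZero (k : Fin n ⊕ Fin (n + 1)) : constantCoeff (tauZero k) = 0 := by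
  rcases k with i | j
  · simp
  · refine Fin.lastCases ?_ (fun i => ?_) j <;> simp

theorem constantCoeff_zetaIncl (j : Fin (n + 1)) : constantCoeff (zetaIncl j) = 0 := by simp

theorem constantCoeff_zZero (k : Fin n ⊕ Fin (n + 1)) : constantCoeff (zZero k) = 0 := by
  rcases k with i | j <;> simp

theorem constantCoeff_chiZero (k : Fin n ⊕ Fin (n + 1)) : constantCoeff (chiZero k) = 0 := by
  rcases k with i | j
  · simp
  · refine Fin.lastCases ?_ (fun i => ?_) j <;> simp

theorem hasSubst_wZero : HasSubst (wZero (n := n)) := hasSubst_zero_coeff constantCoeff_wZero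
theorem hasSubst_zetaZero : HasSubst (zetaZero (n := n)) :=
  hasSubst_zero_coeff constantCoeff_zetaZero
theorem hasSubst_tauZero : HasSubst (tauZero (n := n)) := hasSubst_zero_coeff constantCoeff_tauZero
theorem hasSubst_zetaIncl : HasSubst (zetaIncl (n := n)) :=
  hasSubst_zero_coeff constantCoeff_zetaIncl
theorem hasSubst_zZero : HasSubst (zZero (n := n)) := hasSubst_zero_coeff constantCoeff_zZero
theorem hasSubst_chiZero : HasSubst (chiZero (n := n)) := hasSubst_zero_coeff constantCoeff_chiZero

theorem constantCoeff_conjSeries {σ : Type*} (f : MvPowerSeries σ ℂ) :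
    constantCoeff (conjSeries f) = starRingEnd ℂ (constantCoeff f) := by
  simp [conjSeries]

theorem subst_of_zero {σ τ : Type*} {a : σ → MvPowerSeries τ ℂ} (ha : HasSubst a) :
    subst a (0 : MvPowerSeries σ ℂ) = 0 := by
  rw [← substAlgHom_apply ha, map_zero]

namespace IsNormal

variable {Q : MvPowerSeries (Fin n ⊕ Fin (n + 1)) ℂ} (hQ : IsNormal Q)
include hQ

theorem constantCoeff_eq_zero : constantCoeff Q = 0 := by
  rw [← constantCoeff_subst_of_zero hasSubst_zZero constantCoeff_zZero, hQ.normal_z]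
  simp

/-- Put `τ = 0` in `Q(z, 0, τ) = τ`. -/
theorem subst_zetaZero : subst zetaZero Q = 0 := by
  have h := congrArg (subst zetaZero) hQ.normal_chi
  rw [subst_comp_subst_apply hasSubst_chiZero hasSubst_zetaZero, subst_X hasSubst_zetaZero,
    zetaZero_inr] at h
  rw [← h]
  congr 1
  funext k
  rcases k with i | j
  · simp [subst_X hasSubst_zetaZero]
  · refine Fin.lastCases ?_ (fun i => ?_) j
    · simp [subst_X hasSubst_zetaZero]
    · rw [chiZero_inr_castSucc, zetaZero_inr, subst_of_zero hasSubst_zetaZero]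

theorem subst_zetaZero_pderiv_inl (i : Fin n) :
    subst zetaZero (pderiv ℂ (Sum.inl i) Q) = 0 := by
  have h := congrArg (pderiv ℂ i) hQ.subst_zetaZero
  rw [pderiv_subst hasSubst_zetaZero, map_zero, Fintype.sum_sum_type] at h
  simpa [pderiv_X, Pi.single_apply] using h

theorem subst_zZero_pderiv_inr (j : Fin (n + 1)) :
    subst zZero (pderiv ℂ (Sum.inr j) Q) = if j = Fin.last n then 1 else 0 := by
  have h := congrArg (pderiv ℂ (Sum.inr j)) hQ.normal_z
  rw [pderiv_subst hasSubst_zZero, Fintype.sum_sum_type] at h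
  simpa [pderiv_X, Pi.single_apply, eq_comm] using h

theorem constantCoeff_pderiv_last :
    constantCoeff (pderiv ℂ (Sum.inr (Fin.last n)) Q) = 1 := by
  rw [← constantCoeff_subst_of_zero hasSubst_zZero constantCoeff_zZero,
    hQ.subst_zZero_pderiv_inr]
  simp

theorem constantCoeff_graphPt (i : Fin (n + 1)) : constantCoeff (graphPt Q i) = 0 := by
  refine Fin.lastCases ?_ (fun i => ?_) i
  · simpa using hQ.constantCoeff_eq_zero
  · simp

theorem hasSubst_graphPt : HasSubst (graphPt Q) := hasSubst_zero_coeff hQ.constantCoeff_graphPt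

variable {K : Fin (n + 1) → MvPowerSeries (Fin (n + 1)) ℂ} (hK : ∀ i, constantCoeff (K i) = 0)
include hK

theorem constantCoeff_mapPt (k : Fin n ⊕ Fin (n + 1)) : constantCoeff (mapPt Q K k) = 0 := by
  rcases k with i | j
  · rw [mapPt_inl, constantCoeff_subst_of_zero hQ.hasSubst_graphPt hQ.constantCoeff_graphPt, hK]
  · rw [mapPt_inr, constantCoeff_subst_of_zero hasSubst_zetaIncl constantCoeff_zetaIncl,
      constantCoeff_conjSeries, hK, map_zero]

theorem hasSubst_mapPt : HasSubst (mapPt Q K) := hasSubst_zero_coeff (hQ.constantCoeff_mapPt hK)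

end IsNormal

theorem subst_zetaZero_graphPt {Q : MvPowerSeries (Fin n ⊕ Fin (n + 1)) ℂ} (hQ : IsNormal Q)
    (f : MvPowerSeries (Fin (n + 1)) ℂ) :
    subst zetaZero (subst (graphPt Q) f) = subst wZero f := by
  rw [subst_comp_subst_apply hQ.hasSubst_graphPt hasSubst_zetaZero]
  congr 1
  funext i
  refine Fin.lastCases ?_ (fun i => ?_) i
  · simpa using hQ.subst_zetaZero
  · simp [subst_X hasSubst_zetaZero]

theorem subst_zetaZero_zetaIncl (f : MvPowerSeries (Fin (n + 1)) ℂ) :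
    subst (zetaZero (n := n)) (subst zetaIncl f) = C (constantCoeff f) := by
  rw [subst_comp_subst_apply hasSubst_zetaIncl hasSubst_zetaZero]
  have : (fun s : Fin (n + 1) => subst (zetaZero (n := n)) (zetaIncl s)) = 0 := by
    funext j
    simp [subst_X hasSubst_zetaZero]
  rw [this, subst_zero_eq_C_constantCoeff]
  simp

/-- If `f(z', 0, 0) = 0`, then `f(F(z, Q), H̄)` vanishes for `χ = 0`, `τ = 0`. -/
theorem subst_zetaZero_mapPt {Q : MvPowerSeries (Fin n ⊕ Fin (n + 1)) ℂ} (hQ : IsNormal Q)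
    {K : Fin (n + 1) → MvPowerSeries (Fin (n + 1)) ℂ} (hK : ∀ i, constantCoeff (K i) = 0)
    {f : MvPowerSeries (Fin n ⊕ Fin (n + 1)) ℂ} (hf : subst zetaZero f = 0) :
    subst zetaZero (subst (mapPt Q K) f) = 0 := by
  have hF : HasSubst fun i : Fin n => subst (wZero (n := n)) (K i.castSucc) :=
    hasSubst_zero_coeff fun i => by
      rw [constantCoeff_subst_of_zero hasSubst_wZero constantCoeff_wZero, hK]
  have h := congrArg (subst fun i : Fin n => subst (wZero (n := n)) (K i.castSucc)) hf
  rw [subst_comp_subst_apply hasSubst_zetaZero hF, subst_of_zero hF] at h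
  rw [subst_comp_subst_apply (hQ.hasSubst_mapPt hK) hasSubst_zetaZero, ← h]
  congr 1
  funext k
  rcases k with i | j
  · rw [mapPt_inl, subst_zetaZero_graphPt hQ, zetaZero_inl, subst_X hF]
  · rw [mapPt_inr, subst_zetaZero_zetaIncl, constantCoeff_conjSeries, hK, zetaZero_inr,
      subst_of_zero hF]
    simp

end

/-! ### The basic identity and its derivatives. -/

section

variable {n : ℕ}

/-- `H = (F, G)` sends `w = Q` into `w' = Q'`, in normal coordinates:
`G(z, Q) = Q'(F(z, Q), H̄(χ, τ))`. -/
structure IsNormalMap (Q Q' : MvPowerSeries (Fin n ⊕ Fin (n + 1)) ℂ)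
    (K : Fin (n + 1) → MvPowerSeries (Fin (n + 1)) ℂ) : Prop where
  source : IsNormal Q
  target : IsNormal Q'
  zero : ∀ i, constantCoeff (K i) = 0
  basic : subst (graphPt Q) (K (Fin.last n)) = subst (mapPt Q K) Q'

/-- The factor `G_w - ∑ Q'_{z_i} F_{i, w}` which appears in the derivatives of the basic
identity. -/
def transversalFactor (Q Q' : MvPowerSeries (Fin n ⊕ Fin (n + 1)) ℂ)
    (K : Fin (n + 1) → MvPowerSeries (Fin (n + 1)) ℂ) : MvPowerSeries (Fin n ⊕ Fin (n + 1)) ℂ :=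
  subst (graphPt Q) (pderiv ℂ (Fin.last n) (K (Fin.last n))) -
    ∑ i : Fin n, subst (mapPt Q K) (pderiv ℂ (Sum.inl i) Q') *
      subst (graphPt Q) (pderiv ℂ (Fin.last n) (K i.castSucc))

theorem pderiv_conjSeries {σ : Type*} (f : MvPowerSeries σ ℂ) (i : σ) :
    pderiv ℂ i (conjSeries f) = conjSeries (pderiv ℂ i f) :=
  pderiv_map _ _ _

theorem conjSeries_zero {σ : Type*} : conjSeries (0 : MvPowerSeries σ ℂ) = 0 := by
  simp [conjSeries]

theorem conjSeries_injective {σ : Type*} :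
    Function.Injective (conjSeries : MvPowerSeries σ ℂ → MvPowerSeries σ ℂ) := by
  intro f g h
  ext d
  have := congrArg (coeff d) h
  simp only [conjSeries, coeff_map] at this
  exact (starRingEnd ℂ).injective this

theorem conjSeries_subst {σ τ : Type*} {a : σ → MvPowerSeries τ ℂ} (ha : HasSubst a)
    (f : MvPowerSeries σ ℂ) :
    conjSeries (subst a f) = subst (fun i => conjSeries (a i)) (conjSeries f) :=
  map_subst ha f

theorem conjSeries_X {σ : Type*} (s : σ) : conjSeries (X s : MvPowerSeries σ ℂ) = X s := by
  simp [conjSeries]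

theorem conjSeries_subst_wZero (f : MvPowerSeries (Fin (n + 1)) ℂ) :
    conjSeries (subst wZero f) = subst (wZero (n := n)) (conjSeries f) := by
  rw [conjSeries_subst hasSubst_wZero]
  congr 1
  funext i
  refine Fin.lastCases ?_ (fun i => ?_) i
  · simp [conjSeries_zero]
  · simp [conjSeries_X]

theorem pderiv_inr_subst_zetaIncl (f : MvPowerSeries (Fin (n + 1)) ℂ) (j : Fin (n + 1)) :
    pderiv ℂ (Sum.inr j) (subst (zetaIncl (n := n)) f) = subst zetaIncl (pderiv ℂ j f) := by
  rw [pderiv_subst hasSubst_zetaIncl]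
  simp [pderiv_X, Pi.single_apply]

theorem pderiv_inl_subst_zetaIncl (f : MvPowerSeries (Fin (n + 1)) ℂ) (i : Fin n) :
    pderiv ℂ (Sum.inl i) (subst (zetaIncl (n := n)) f) = 0 := by
  rw [pderiv_subst hasSubst_zetaIncl]
  simp

theorem IsNormal.pderiv_inr_subst_graphPt {Q : MvPowerSeries (Fin n ⊕ Fin (n + 1)) ℂ}
    (hQ : IsNormal Q) (f : MvPowerSeries (Fin (n + 1)) ℂ) (j : Fin (n + 1)) :
    pderiv ℂ (Sum.inr j) (subst (graphPt Q) f) =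
      subst (graphPt Q) (pderiv ℂ (Fin.last n) f) * pderiv ℂ (Sum.inr j) Q := by
  rw [pderiv_subst hQ.hasSubst_graphPt, Fin.sum_univ_castSucc]
  simp

theorem pderiv_subst_wZero (f : MvPowerSeries (Fin (n + 1)) ℂ) (j : Fin n) :
    pderiv ℂ j (subst (wZero (n := n)) f) = subst wZero (pderiv ℂ j.castSucc f) := by
  rw [pderiv_subst hasSubst_wZero, Fin.sum_univ_castSucc]
  simp [pderiv_X, Pi.single_apply]

theorem pderiv_inr_subst_tauZero (f : MvPowerSeries (Fin n ⊕ Fin (n + 1)) ℂ) (j : Fin n) :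
    pderiv ℂ (Sum.inr j) (subst (tauZero (n := n)) f) =
      subst tauZero (pderiv ℂ (Sum.inr j.castSucc) f) := by
  rw [pderiv_subst hasSubst_tauZero, Fintype.sum_sum_type, Fin.sum_univ_castSucc]
  simp [pderiv_X, Pi.single_apply]

/-- The variables `χ` among `(z, χ)`. -/
def chiIncl : Fin n → MvPowerSeries (Fin n ⊕ Fin n) ℂ := fun j => X (Sum.inr j)

@[simp] theorem chiIncl_apply (j : Fin n) : chiIncl j = X (Sum.inr j) := rfl

theorem constantCoeff_chiIncl (j : Fin n) : constantCoeff (chiIncl j) = 0 := by simp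

theorem hasSubst_chiIncl : HasSubst (chiIncl (n := n)) := hasSubst_zero_coeff constantCoeff_chiIncl

theorem subst_tauZero_zetaIncl (f : MvPowerSeries (Fin (n + 1)) ℂ) :
    subst (tauZero (n := n)) (subst zetaIncl f) = subst chiIncl (subst wZero f) := by
  rw [subst_comp_subst_apply hasSubst_zetaIncl hasSubst_tauZero,
    subst_comp_subst_apply hasSubst_wZero hasSubst_chiIncl]
  congr 1
  funext j
  rw [zetaIncl_apply, subst_X hasSubst_tauZero]
  refine Fin.lastCases ?_ (fun i => ?_) j
  · simp [subst_of_zero hasSubst_chiIncl]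
  · simp [subst_X hasSubst_chiIncl]

/-- The substitution `(z', χ') = (F(z, Q(z, χ, 0)), F̄(χ, 0))`. -/
def mapPtTauZero (Q : MvPowerSeries (Fin n ⊕ Fin (n + 1)) ℂ)
    (K : Fin (n + 1) → MvPowerSeries (Fin (n + 1)) ℂ) :
    Fin n ⊕ Fin n → MvPowerSeries (Fin n ⊕ Fin n) ℂ :=
  Sum.elim (fun i => subst tauZero (subst (graphPt Q) (K i.castSucc)))
    (fun k => subst chiIncl (conjSeries (subst wZero (K k.castSucc))))

namespace IsNormalMap

variable {Q Q' : MvPowerSeries (Fin n ⊕ Fin (n + 1)) ℂ}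
  {K : Fin (n + 1) → MvPowerSeries (Fin (n + 1)) ℂ} (h : IsNormalMap Q Q' K)
include h

/-- This is the basic identity at `χ = τ = 0`, where `Q(z, 0, 0) = 0`, `H̄(0) = 0` and `Q'(z', 0, 0)
= 0`. -/
theorem subst_wZero_last : subst wZero (K (Fin.last n)) = 0 := by
  rw [← subst_zetaZero_graphPt h.source, h.basic]
  exact subst_zetaZero_mapPt h.source h.zero h.target.subst_zetaZero

/-- Differentiate the basic identity in `ζ_j`. The variable `ζ_j` enters through `w = Q` and through
`H̄`; the contributions through `Q` are collected on the left. -/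
theorem transversalFactor_mul_pderiv (j : Fin (n + 1)) :
    transversalFactor Q Q' K * pderiv ℂ (Sum.inr j) Q =
      ∑ k, subst (mapPt Q K) (pderiv ℂ (Sum.inr k) Q') *
        subst zetaIncl (conjSeries (pderiv ℂ j (K k))) := by
  have hd := congrArg (pderiv ℂ (Sum.inr j)) h.basic
  rw [h.source.pderiv_inr_subst_graphPt, pderiv_subst (h.source.hasSubst_mapPt h.zero),
    Fintype.sum_sum_type] at hd
  simp only [mapPt_inl, mapPt_inr, h.source.pderiv_inr_subst_graphPt,
    pderiv_inr_subst_zetaIncl, pderiv_conjSeries] at hd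
  rw [transversalFactor, sub_mul, hd, Finset.sum_mul]
  simp only [mul_assoc]
  exact add_sub_cancel_left _ _

/-- The sum drops out because `Q'(z', 0, 0) = 0` gives `Q'_{z_i}(z', 0, 0) = 0`. -/
theorem subst_zetaZero_transversalFactor :
    subst zetaZero (transversalFactor Q Q' K) =
      subst wZero (pderiv ℂ (Fin.last n) (K (Fin.last n))) := by
  rw [transversalFactor, subst_sub hasSubst_zetaZero, subst_zetaZero_graphPt h.source,
    ← substAlgHom_apply hasSubst_zetaZero (∑ i : Fin n, _), map_sum, Finset.sum_eq_zero, sub_zero]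
  intro i _
  rw [map_mul, substAlgHom_apply, subst_zetaZero_mapPt h.source h.zero
    (h.target.subst_zetaZero_pderiv_inl i), zero_mul]

theorem constantCoeff_transversalFactor :
    constantCoeff (transversalFactor Q Q' K) =
      constantCoeff (pderiv ℂ (Fin.last n) (K (Fin.last n))) := by
  rw [← constantCoeff_subst_of_zero hasSubst_zetaZero constantCoeff_zetaZero,
    h.subst_zetaZero_transversalFactor,
    constantCoeff_subst_of_zero hasSubst_wZero constantCoeff_wZero]

theorem constantCoeff_mapPtTauZero (k : Fin n ⊕ Fin n) :
    constantCoeff (mapPtTauZero Q K k) = 0 := by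
  rcases k with i | j
  · rw [mapPtTauZero, Sum.elim_inl,
      constantCoeff_subst_of_zero hasSubst_tauZero constantCoeff_tauZero,
      constantCoeff_subst_of_zero h.source.hasSubst_graphPt h.source.constantCoeff_graphPt, h.zero]
  · rw [mapPtTauZero, Sum.elim_inr,
      constantCoeff_subst_of_zero hasSubst_chiIncl constantCoeff_chiIncl, constantCoeff_conjSeries,
      constantCoeff_subst_of_zero hasSubst_wZero constantCoeff_wZero, h.zero, map_zero]

theorem hasSubst_mapPtTauZero : HasSubst (mapPtTauZero Q K) :=
  hasSubst_zero_coeff h.constantCoeff_mapPtTauZero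

/-- Since `Ḡ(χ, 0) = 0`, setting `τ = 0` in the source also sets `τ' = 0` in the target. -/
theorem subst_tauZero_mapPt (f : MvPowerSeries (Fin n ⊕ Fin (n + 1)) ℂ) :
    subst tauZero (subst (mapPt Q K) f) = subst (mapPtTauZero Q K) (subst tauZero f) := by
  rw [subst_comp_subst_apply (h.source.hasSubst_mapPt h.zero) hasSubst_tauZero,
    subst_comp_subst_apply hasSubst_tauZero h.hasSubst_mapPtTauZero]
  congr 1
  funext k
  rcases k with i | j
  · rw [mapPt_inl, tauZero_inl, subst_X h.hasSubst_mapPtTauZero, mapPtTauZero, Sum.elim_inl]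
  · rw [mapPt_inr, subst_tauZero_zetaIncl, ← conjSeries_subst_wZero]
    refine Fin.lastCases ?_ (fun i => ?_) j
    · rw [h.subst_wZero_last, conjSeries_zero, subst_of_zero hasSubst_chiIncl, tauZero_inr_last,
        subst_of_zero h.hasSubst_mapPtTauZero]
    · rw [tauZero_inr_castSucc, subst_X h.hasSubst_mapPtTauZero, mapPtTauZero, Sum.elim_inr]

theorem basic_tauZero :
    subst tauZero (subst (graphPt Q) (K (Fin.last n))) =
      subst (mapPtTauZero Q K) (subst tauZero Q') := by
  rw [h.basic, h.subst_tauZero_mapPt]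

theorem subst_wZero_pderiv_last (j : Fin n) :
    subst wZero (pderiv ℂ j.castSucc (K (Fin.last n))) = 0 := by
  rw [← pderiv_subst_wZero, h.subst_wZero_last, map_zero]

/-- The term with `k` last disappears, because `G(z, 0) = 0` makes the `z`-derivatives of `G` vanish
there; a square system of size `n` remains. -/
theorem transversalFactor_mul_pderiv_tauZero (j : Fin n) :
    subst tauZero (transversalFactor Q Q' K) * pderiv ℂ (Sum.inr j) (subst tauZero Q) =
      ∑ k : Fin n, subst (mapPtTauZero Q K) (pderiv ℂ (Sum.inr k) (subst tauZero Q')) *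
        subst chiIncl (conjSeries (subst wZero (pderiv ℂ j.castSucc (K k.castSucc)))) := by
  have hd := congrArg (subst (tauZero (n := n))) (h.transversalFactor_mul_pderiv j.castSucc)
  rw [← substAlgHom_apply hasSubst_tauZero (∑ k, _), map_sum, subst_mul hasSubst_tauZero] at hd
  simp only [map_mul, substAlgHom_apply, h.subst_tauZero_mapPt, subst_tauZero_zetaIncl,
    ← conjSeries_subst_wZero] at hd
  rw [pderiv_inr_subst_tauZero, hd, Fin.sum_univ_castSucc, h.subst_wZero_pderiv_last,
    conjSeries_zero, subst_of_zero hasSubst_chiIncl, mul_zero, add_zero]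
  simp only [pderiv_inr_subst_tauZero]

end IsNormalMap

end

/-! ### Transversal maps of class `𝒞` hypersurfaces are not totally degenerate. -/

section

variable {n : ℕ}

section Inclusion

variable {σ τ : Type*} [Finite σ] [Finite τ]

theorem subst_X_inr_injective : Function.Injective
    (subst (fun t => X (Sum.inr t) : τ → MvPowerSeries (σ ⊕ τ) ℂ) :
      MvPowerSeries τ ℂ → MvPowerSeries (σ ⊕ τ) ℂ) := by
  have h1 : HasSubst (fun t => X (Sum.inr t) : τ → MvPowerSeries (σ ⊕ τ) ℂ) :=
    hasSubst_zero_coeff fun t => by simp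
  have h2 : HasSubst (Sum.elim (fun _ => 0) X : σ ⊕ τ → MvPowerSeries τ ℂ) :=
    hasSubst_zero_coeff fun t => by rcases t with i | j <;> simp
  refine Function.LeftInverse.injective
    (g := subst (Sum.elim (fun _ => 0) X : σ ⊕ τ → MvPowerSeries τ ℂ)) fun f => ?_
  rw [subst_comp_subst_apply h1 h2]
  simp only [subst_X h2, Sum.elim_inr]
  exact congrFun subst_self f

end Inclusion

theorem zetaIncl_injective : Function.Injective
    (subst (zetaIncl (n := n)) :
      MvPowerSeries (Fin (n + 1)) ℂ → MvPowerSeries (Fin n ⊕ Fin (n + 1)) ℂ) :=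
  subst_X_inr_injective

theorem chiIncl_injective : Function.Injective
    (subst (chiIncl (n := n)) : MvPowerSeries (Fin n) ℂ → MvPowerSeries (Fin n ⊕ Fin n) ℂ) :=
  subst_X_inr_injective

theorem pderiv_inl_subst_chiIncl (f : MvPowerSeries (Fin n) ℂ) (i : Fin n) :
    pderiv ℂ (Sum.inl i) (subst (chiIncl (n := n)) f) = 0 := by
  rw [pderiv_subst hasSubst_chiIncl]
  simp

theorem pderiv_inr_subst_chiIncl (f : MvPowerSeries (Fin n) ℂ) (j : Fin n) :
    pderiv ℂ (Sum.inr j) (subst (chiIncl (n := n)) f) = subst chiIncl (pderiv ℂ j f) := by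
  rw [pderiv_subst hasSubst_chiIncl]
  simp [pderiv_X, Pi.single_apply]

instance isDomain_mvPowerSeries {σ : Type*} : IsDomain (MvPowerSeries σ ℂ) :=
  NoZeroDivisors.to_isDomain _

/-- The coefficient of `z^α` in `f(z, χ)`. -/
def zPart (α : Fin n →₀ ℕ) (f : MvPowerSeries (Fin n ⊕ Fin n) ℂ) : MvPowerSeries (Fin n) ℂ :=
  fun β => coeff (Finsupp.sumElim α β) f

theorem coeff_zPart (α β : Fin n →₀ ℕ) (f : MvPowerSeries (Fin n ⊕ Fin n) ℂ) :
    coeff β (zPart α f) = coeff (Finsupp.sumElim α β) f := rfl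

theorem zPart_zero (α : Fin n →₀ ℕ) : zPart α 0 = 0 := by
  ext β
  simp [coeff_zPart]

theorem zPart_sum {ι : Type*} (s : Finset ι) (α : Fin n →₀ ℕ)
    (f : ι → MvPowerSeries (Fin n ⊕ Fin n) ℂ) :
    zPart α (∑ i ∈ s, f i) = ∑ i ∈ s, zPart α (f i) := by
  ext β
  simp [coeff_zPart]

theorem zPart_pderiv_inr (α : Fin n →₀ ℕ) (f : MvPowerSeries (Fin n ⊕ Fin n) ℂ) (j : Fin n) :
    zPart α (pderiv ℂ (Sum.inr j) f) = pderiv ℂ j (zPart α f) := by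
  ext β
  rw [coeff_zPart, coeff_pderiv, coeff_pderiv, coeff_zPart]
  have hs : Finsupp.sumElim α (β + Finsupp.single j 1) =
      Finsupp.sumElim α β + Finsupp.single (Sum.inr j) 1 := by
    refine Finsupp.ext fun k => ?_
    rcases k with i | i <;> simp [Finsupp.single_apply]
  rw [hs]
  simp

theorem coeff_sumElim_zero_subst_chiIncl (β : Fin n →₀ ℕ) (v : MvPowerSeries (Fin n) ℂ) :
    coeff (Finsupp.sumElim 0 β) (subst (chiIncl (n := n)) v) = coeff β v := by
  have h2 : HasSubst (Sum.elim (fun _ => 0) X : Fin n ⊕ Fin n → MvPowerSeries (Fin n) ℂ) :=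
    hasSubst_zero_coeff fun t => by rcases t with i | j <;> simp
  have h3 := coeff_subst_of_partialInv h2 Sum.inr Sum.inr_injective (fun t => rfl) (fun s hs => by
    rcases s with i | j
    · rfl
    · exact absurd ⟨j, rfl⟩ hs) (subst (chiIncl (n := n)) v) β
  rw [subst_comp_subst_apply hasSubst_chiIncl h2] at h3
  simp only [chiIncl_apply, subst_X h2, Sum.elim_inr] at h3
  rw [subst_self, id] at h3
  rw [h3]
  refine congrArg (fun d => coeff d _) (Finsupp.ext fun k => ?_)
  rcases k with i | i
  · rw [Finsupp.mapDomain_of_notMem_range _ _ (by simp)]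
    simp
  · rw [Finsupp.mapDomain_apply Sum.inr_injective]
    simp

/-- Taking the coefficient of `z^α` is linear over series in `χ`. Thus one relation in `(z, χ)` with
coefficients in `χ` splits into the family of relations that class `𝒞` controls. -/
theorem zPart_mul_chiIncl (α : Fin n →₀ ℕ) (f : MvPowerSeries (Fin n ⊕ Fin n) ℂ)
    (v : MvPowerSeries (Fin n) ℂ) :
    zPart α (f * subst chiIncl v) = zPart α f * v := by
  classical
  ext β
  rw [coeff_zPart, mul_comm, mul_comm (zPart α f), coeff_mul, coeff_mul]
  symm
  -- Only splittings which give all of `z^α` to `f` contribute, since the other factor has no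
  -- monomial involving `z`.
  refine Finset.sum_of_injOn (fun p => (Finsupp.sumElim 0 p.1, Finsupp.sumElim α p.2))
    ?_ ?_ ?_ ?_
  · rintro ⟨a, b⟩ _ ⟨a', b'⟩ _ hab
    simp only [Prod.mk.injEq] at hab
    ext k
    · simpa using DFunLike.congr_fun hab.1 (Sum.inr k)
    · simpa using DFunLike.congr_fun hab.2 (Sum.inr k)
  · rintro ⟨a, b⟩ hab
    simp only [Finset.mem_coe, Finset.HasAntidiagonal.mem_antidiagonal] at hab ⊢
    rw [← hab]
    ext k
    rcases k with i | i <;> simp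
  · rintro ⟨a, b⟩ hab hnot
    simp only [Finset.HasAntidiagonal.mem_antidiagonal] at hab
    by_cases ha : ∀ i, a (Sum.inl i) = 0
    · refine absurd ?_ hnot
      refine ⟨(a.comapDomain Sum.inr Sum.inr_injective.injOn,
        b.comapDomain Sum.inr Sum.inr_injective.injOn), ?_, ?_⟩
      · simp only [Finset.mem_coe, Finset.HasAntidiagonal.mem_antidiagonal]
        ext k
        simpa using DFunLike.congr_fun hab (Sum.inr k)
      · simp only [Prod.mk.injEq]
        constructor
        · ext k
          rcases k with i | i
          · simp [ha]
          · simp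
        · ext k
          rcases k with i | i
          · have := DFunLike.congr_fun hab (Sum.inl i)
            simp only [Finsupp.add_apply, ha, zero_add] at this
            simpa using this.symm
          · simp
    · push Not at ha
      obtain ⟨i, hi⟩ := ha
      rw [coeff_eq_zero_of_pderiv_eq_zero (pderiv_inl_subst_chiIncl v i) hi, zero_mul]
  · rintro ⟨a, b⟩ _
    rw [coeff_sumElim_zero_subst_chiIncl, coeff_zPart]

/-- The matrix `∂F/∂z (z, 0)` of a map `H = (F, G)`. -/
def restrictedJacobian (K : Fin (n + 1) → MvPowerSeries (Fin (n + 1)) ℂ) :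
    Matrix (Fin n) (Fin n) (MvPowerSeries (Fin n) ℂ) :=
  Matrix.of fun i j => subst wZero (pderiv ℂ j.castSucc (K i.castSucc))

/-- A transversal map of a hypersurface of class `𝒞` is not totally degenerate. -/
theorem IsNormalMap.det_restrictedJacobian_ne_zero
    {Q Q' : MvPowerSeries (Fin n ⊕ Fin (n + 1)) ℂ}
    {K : Fin (n + 1) → MvPowerSeries (Fin (n + 1)) ℂ} (h : IsNormalMap Q Q' K)
    (hC : ∀ v : Fin n → MvPowerSeries (Fin n) ℂ,
      (∀ α, ∑ j, pderiv ℂ j (zPart α (subst tauZero Q)) * v j = 0) → v = 0)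
    (hG : constantCoeff (pderiv ℂ (Fin.last n) (K (Fin.last n))) ≠ 0) :
    (restrictedJacobian K).det ≠ 0 := by
  intro hdet
  have hdet' : ((restrictedJacobian K).map (MvPowerSeries.map (starRingEnd ℂ))).det = 0 := by
    rw [← RingHom.mapMatrix_apply, ← RingHom.map_det, hdet, map_zero]
  obtain ⟨v, hv0, hv⟩ := Matrix.exists_mulVec_eq_zero_iff.mpr hdet'
  refine hv0 (hC v fun α => ?_)
  have hu : subst tauZero (transversalFactor Q Q' K) ≠ 0 := by
    intro h0
    rw [← h.constantCoeff_transversalFactor,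
      ← constantCoeff_subst_of_zero hasSubst_tauZero constantCoeff_tauZero, h0, map_zero] at hG
    exact hG rfl
  -- Pairing the system at `τ = 0` with `v` makes its right side vanish; then cancel `u`, which is
  -- nonzero at `τ = 0` because its constant term is `G_w(0)`.
  have hD : ∑ j, pderiv ℂ (Sum.inr j) (subst tauZero Q) * subst chiIncl (v j) = 0 := by
    refine (mul_eq_zero.mp ?_).resolve_left hu
    rw [Finset.mul_sum]
    simp only [← mul_assoc, h.transversalFactor_mul_pderiv_tauZero, Finset.sum_mul]
    rw [Finset.sum_comm]
    refine Finset.sum_eq_zero fun k _ => ?_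
    have hk := congrArg (subst (chiIncl (n := n))) (congrFun hv k)
    rw [Matrix.mulVec, dotProduct, Pi.zero_apply, subst_of_zero hasSubst_chiIncl,
      ← substAlgHom_apply hasSubst_chiIncl, map_sum] at hk
    simp only [mul_assoc, ← Finset.mul_sum]
    convert mul_zero _ using 2
    rw [← hk]
    refine Finset.sum_congr rfl fun j _ => ?_
    rw [substAlgHom_apply, subst_mul hasSubst_chiIncl]
    rfl
  have hz := congrArg (zPart α) hD
  rw [zPart_sum, zPart_zero] at hz
  simpa only [zPart_mul_chiIncl, zPart_pderiv_inr] using hz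

end

/-! ### The converse: dividing by the transversal factor. -/

section

variable {n : ℕ}

/-- The restriction of `f(z, χ)` to `χ = 0`. -/
def chiToZero : Fin n ⊕ Fin n → MvPowerSeries (Fin n) ℂ := Sum.elim X (fun _ => 0)

/-- The restriction of `f(z, χ)` to `z = 0`, as a series in `(z, χ)`. -/
def zToZero : Fin n ⊕ Fin n → MvPowerSeries (Fin n ⊕ Fin n) ℂ :=
  Sum.elim (fun _ => 0) (fun j => X (Sum.inr j))

@[simp] theorem chiToZero_inl (i : Fin n) : chiToZero (Sum.inl i) = X i := rfl
@[simp] theorem chiToZero_inr (i : Fin n) : chiToZero (Sum.inr i) = 0 := rfl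
@[simp] theorem zToZero_inl (i : Fin n) : zToZero (Sum.inl i) = 0 := rfl
@[simp] theorem zToZero_inr (i : Fin n) : zToZero (Sum.inr i) = X (Sum.inr i) := rfl

theorem hasSubst_chiToZero : HasSubst (chiToZero (n := n)) :=
  hasSubst_zero_coeff fun k => by rcases k with i | i <;> simp

theorem hasSubst_zToZero : HasSubst (zToZero (n := n)) :=
  hasSubst_zero_coeff fun k => by rcases k with i | i <;> simp

theorem subst_chiToZero_tauZero (f : MvPowerSeries (Fin n ⊕ Fin (n + 1)) ℂ) :
    subst (chiToZero (n := n)) (subst tauZero f) = subst zetaZero f := by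
  rw [subst_comp_subst_apply hasSubst_tauZero hasSubst_chiToZero]
  congr 1
  funext k
  rcases k with i | j
  · simp [subst_X hasSubst_chiToZero]
  · refine Fin.lastCases ?_ (fun i => ?_) j
    · simp [subst_of_zero hasSubst_chiToZero]
    · simp [subst_X hasSubst_chiToZero]

theorem subst_zToZero_tauZero (f : MvPowerSeries (Fin n ⊕ Fin (n + 1)) ℂ) :
    subst (zToZero (n := n)) (subst tauZero f) = subst tauZero (subst zZero f) := by
  rw [subst_comp_subst_apply hasSubst_tauZero hasSubst_zToZero,
    subst_comp_subst_apply hasSubst_zZero hasSubst_tauZero]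
  congr 1
  funext k
  rcases k with i | j
  · simp [subst_X hasSubst_zToZero, subst_of_zero hasSubst_tauZero]
  · refine Fin.lastCases ?_ (fun i => ?_) j
    · simp [subst_of_zero hasSubst_zToZero, subst_X hasSubst_tauZero]
    · simp [subst_X hasSubst_zToZero, subst_X hasSubst_tauZero]

theorem pderiv_subst_chiToZero (f : MvPowerSeries (Fin n ⊕ Fin n) ℂ) (j : Fin n) :
    pderiv ℂ j (subst (chiToZero (n := n)) f) = subst chiToZero (pderiv ℂ (Sum.inl j) f) := by
  rw [pderiv_subst hasSubst_chiToZero, Fintype.sum_sum_type]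
  simp [pderiv_X, Pi.single_apply]

theorem subst_zZero_zetaIncl (f : MvPowerSeries (Fin (n + 1)) ℂ) :
    subst (zZero (n := n)) (subst zetaIncl f) = subst zetaIncl f := by
  rw [subst_comp_subst_apply hasSubst_zetaIncl hasSubst_zZero]
  congr 1
  funext k
  simp [subst_X hasSubst_zZero]

/-- A series in `(z, χ)` which vanishes for `χ = 0` and does not depend on `χ` is zero. -/
theorem eq_zero_of_pderiv_inr_eq_zero {f : MvPowerSeries (Fin n ⊕ Fin n) ℂ}
    (h0 : subst chiToZero f = 0) (hd : ∀ k, pderiv ℂ (Sum.inr k) f = 0) : f = 0 := by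
  refine eq_zero_of_pderiv_eq_zero_of_subst hasSubst_chiToZero Sum.inl Sum.inl_injective
    (fun _ => rfl) (fun s hs => ?_) h0 (fun s hs => ?_)
  all_goals rcases s with i | i
  · exact absurd ⟨i, rfl⟩ hs
  · rfl
  · exact absurd ⟨i, rfl⟩ hs
  · exact hd i

/-- A factor `u(z, ζ)` of a nonzero series in `ζ` is a unit unless `u(z, 0) = 0`. -/
theorem constantCoeff_ne_zero_of_mul_eq_zetaIncl
    {u E : MvPowerSeries (Fin n ⊕ Fin (n + 1)) ℂ} {P : MvPowerSeries (Fin (n + 1)) ℂ}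
    (h : u * E = subst zetaIncl P) (hP : P ≠ 0) (hu : subst zetaZero u ≠ 0) :
    constantCoeff u ≠ 0 := by
  -- Here `ζ` precedes `z`, so the lexicographically least exponent `d` of `u` minimises its
  -- `ζ`-part first; that part is zero because `u(z, 0) ≠ 0`. Least exponents add under products and
  -- `u E` involves no `z`, so the `z`-part of `d` is zero as well.
  let L : LinearOrder (Fin n ⊕ Fin (n + 1)) :=
    LinearOrder.lift' (fun k => toLex k.swap) (toLex.injective.comp Sum.swap_leftInverse.injective)
  have : @WellFoundedGT _ L.toLT := @Finite.to_wellFoundedGT _ _ L.toPreorder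
  have hP' : subst (zetaIncl (n := n)) P ≠ 0 := fun h0 =>
    hP (zetaIncl_injective (h0.trans (subst_of_zero hasSubst_zetaIncl).symm))
  have hu0 : u ≠ 0 := by
    rintro rfl
    exact hP' (by rw [← h, zero_mul])
  have hE0 : E ≠ 0 := by
    rintro rfl
    exact hP' (by rw [← h, mul_zero])
  obtain ⟨d, hd⟩ := exists_finsupp_eq_lexOrder_of_ne_zero hu0
  obtain ⟨e, he⟩ := exists_finsupp_eq_lexOrder_of_ne_zero hE0
  obtain ⟨a, ha⟩ : ∃ a, coeff a (subst zetaZero u) ≠ 0 := by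
    by_contra hcon
    push Not at hcon
    exact hu (MvPowerSeries.ext fun a => by rw [hcon, map_zero])
  rw [coeff_subst_of_partialInv hasSubst_zetaZero Sum.inl Sum.inl_injective (fun _ => rfl)
    (fun s hs => by
      rcases s with i | i
      · exact absurd ⟨i, rfl⟩ hs
      · rfl)] at ha
  have hle := lexOrder_le_of_coeff_ne_zero ha
  rw [hd, WithTop.coe_le_coe] at hle
  have hdr : ∀ j, d (Sum.inr j) = 0 := by
    intro j
    have har : ∀ j : Fin (n + 1), Finsupp.mapDomain (Sum.inl : Fin n → Fin n ⊕ Fin (n + 1)) a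
        (Sum.inr j) = 0 := fun j => Finsupp.mapDomain_of_notMem_range _ _ (by simp)
    rcases hle.eq_or_lt with heq | hlt
    · rw [toLex.injective heq, har]
    · obtain ⟨k, hk1, hk2⟩ := hlt
      rcases k with i | i
      · have := hk1 (Sum.inr j) (Sum.Lex.inl_lt_inr _ _)
        exact this.trans (har j)
      · exact absurd (hk2.trans_eq (har i)) (Nat.not_lt_zero _)
  have hde : coeff (d + e) (u * E) ≠ 0 := by
    rw [coeff_mul_of_add_lexOrder hd he]
    exact mul_ne_zero (coeff_ne_zero_of_lexOrder hd.symm) (coeff_ne_zero_of_lexOrder he.symm)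
  have hdl : ∀ i, d (Sum.inl i) = 0 := by
    intro i
    by_contra hi
    refine hde ?_
    rw [h]
    refine coeff_eq_zero_of_pderiv_eq_zero (pderiv_inl_subst_zetaIncl P i) ?_
    rw [Finsupp.add_apply]
    omega
  have hd0 : d = 0 := by
    refine Finsupp.ext fun k => ?_
    rcases k with i | j
    · exact hdl i
    · exact hdr j
  have := coeff_ne_zero_of_lexOrder hd.symm
  rwa [hd0, coeff_zero_eq_constantCoeff_apply] at this

/-- The Jacobian matrix of a map. -/
def jacobian (K : Fin (n + 1) → MvPowerSeries (Fin (n + 1)) ℂ) :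
    Matrix (Fin (n + 1)) (Fin (n + 1)) (MvPowerSeries (Fin (n + 1)) ℂ) :=
  Matrix.of fun i j => pderiv ℂ j (K i)

/-- Substitution of `ζ` in the conjugate of a series, as a ring homomorphism. -/
def conjZeta : MvPowerSeries (Fin (n + 1)) ℂ →+* MvPowerSeries (Fin n ⊕ Fin (n + 1)) ℂ :=
  (substAlgHom (hasSubst_zetaIncl (n := n))).toRingHom.comp (MvPowerSeries.map (starRingEnd ℂ))

theorem conjZeta_apply (f : MvPowerSeries (Fin (n + 1)) ℂ) :
    conjZeta f = subst (zetaIncl (n := n)) (conjSeries f) :=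
  substAlgHom_apply hasSubst_zetaIncl _

theorem restrictedJacobian_eq (K : Fin (n + 1) → MvPowerSeries (Fin (n + 1)) ℂ) :
    restrictedJacobian K = ((jacobian K).submatrix Fin.castSucc Fin.castSucc).map
      (substAlgHom (hasSubst_wZero (n := n))) := by
  ext1 i j
  simp [restrictedJacobian, jacobian]

theorem subst_wZero_det_submatrix (K : Fin (n + 1) → MvPowerSeries (Fin (n + 1)) ℂ) :
    subst wZero ((jacobian K).submatrix Fin.castSucc Fin.castSucc).det =
      (restrictedJacobian K).det := by
  rw [← substAlgHom_apply hasSubst_wZero, AlgHom.map_det, restrictedJacobian_eq]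
  rfl

namespace IsNormalMap

variable {Q Q' : MvPowerSeries (Fin n ⊕ Fin (n + 1)) ℂ}
  {K : Fin (n + 1) → MvPowerSeries (Fin (n + 1)) ℂ} (h : IsNormalMap Q Q' K)
include h

/-- Along `w = 0` the row of `G` is `(0, …, 0, G_w)`, so the Jacobian is block triangular there. -/
theorem subst_wZero_det_jacobian :
    subst wZero (jacobian K).det =
      (restrictedJacobian K).det * subst wZero (pderiv ℂ (Fin.last n) (K (Fin.last n))) := by
  rw [Matrix.det_succ_row _ (Fin.last n), Fin.sum_univ_castSucc, ← subst_wZero_det_submatrix,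
    ← substAlgHom_apply hasSubst_wZero, map_add, map_sum, Finset.sum_eq_zero, zero_add]
  · rw [Fin.succAbove_last, ← two_mul, pow_mul, neg_one_sq, one_pow, one_mul, map_mul, mul_comm,
      substAlgHom_apply, substAlgHom_apply, jacobian, Matrix.of_apply]
  · intro j _
    rw [map_mul, map_mul, substAlgHom_apply, substAlgHom_apply, jacobian, Matrix.of_apply,
      h.subst_wZero_pderiv_last, mul_zero, zero_mul]

/-- The minor of the Jacobian system which is used to divide by `G_w - ∑ Q'_{z_i} F_{i, w}`. -/
theorem exists_transversalFactor_mul :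
    ∃ E : MvPowerSeries (Fin n ⊕ Fin (n + 1)) ℂ,
      transversalFactor Q Q' K * E = conjZeta (jacobian K).det *
        subst (mapPt Q K) (pderiv ℂ (Sum.inr (Fin.last n)) Q') ∧
      subst zZero E = conjZeta ((jacobian K).submatrix Fin.castSucc Fin.castSucc).det := by
  set J := (jacobian K).map (conjZeta (n := n)) with hJ
  set b : Fin (n + 1) → MvPowerSeries (Fin n ⊕ Fin (n + 1)) ℂ :=
    fun k => subst (mapPt Q K) (pderiv ℂ (Sum.inr k) Q') with hb
  set q : Fin (n + 1) → MvPowerSeries (Fin n ⊕ Fin (n + 1)) ℂ :=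
    fun j => pderiv ℂ (Sum.inr j) Q with hq
  have hdet : J.det = conjZeta (jacobian K).det := by
    rw [RingHom.map_det]
    rfl
  have hmul : transversalFactor Q Q' K • q = Matrix.vecMul b J := by
    funext j
    rw [Pi.smul_apply, smul_eq_mul, hq, h.transversalFactor_mul_pderiv]
    simp [Matrix.vecMul, dotProduct, hJ, hb, jacobian, conjZeta_apply]
  -- Multiplying `u q = b J` on the right by the adjugate gives `u (q adj J) = det J · b`; `E` is
  -- the last component of `q adj J`. At `z = 0` one has `q = (0, …, 0, 1)`, which leaves the lower
  -- right entry of the adjugate.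
  refine ⟨Matrix.vecMul q J.adjugate (Fin.last n), ?_, ?_⟩
  · have h1 : Matrix.vecMul (transversalFactor Q Q' K • q) J.adjugate = J.det • b := by
      rw [hmul, Matrix.vecMul_vecMul, Matrix.mul_adjugate, Matrix.vecMul_smul, Matrix.vecMul_one]
    rw [Matrix.smul_vecMul] at h1
    rw [← hdet]
    exact congrFun h1 (Fin.last n)
  · rw [Matrix.vecMul, dotProduct, ← substAlgHom_apply hasSubst_zZero, map_sum,
      Finset.sum_eq_single (Fin.last n)]
    · rw [map_mul, substAlgHom_apply, substAlgHom_apply, hq,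
        h.source.subst_zZero_pderiv_inr, if_pos rfl, one_mul,
        Matrix.adjugate_fin_succ_eq_det_submatrix]
      have hs : (J.submatrix (Fin.last n).succAbove (Fin.last n).succAbove).det =
          conjZeta ((jacobian K).submatrix Fin.castSucc Fin.castSucc).det := by
        rw [RingHom.map_det]
        simp only [Fin.succAbove_last]
        rfl
      rw [hs, ← two_mul, pow_mul, neg_one_sq, one_pow, one_mul, conjZeta_apply,
        subst_zZero_zetaIncl]
    · intro j _ hj
      rw [map_mul, substAlgHom_apply, substAlgHom_apply, hq,
        h.source.subst_zZero_pderiv_inr, if_neg hj, zero_mul]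
    · simp

theorem constantCoeff_mapPt_pderiv_last :
    constantCoeff (subst (mapPt Q K) (pderiv ℂ (Sum.inr (Fin.last n)) Q')) = 1 := by
  rw [constantCoeff_subst_of_zero (h.source.hasSubst_mapPt h.zero)
    (h.source.constantCoeff_mapPt h.zero), h.target.constantCoeff_pderiv_last]

/-- If `∂F/∂z (z, 0)` has generic rank `n` and `G_w(z, 0) ≠ 0`, then `G_w(0) ≠ 0`. -/
theorem constantCoeff_pderiv_last_ne_zero (hdet : (restrictedJacobian K).det ≠ 0)
    (hg : subst wZero (pderiv ℂ (Fin.last n) (K (Fin.last n))) ≠ 0) :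
    constantCoeff (pderiv ℂ (Fin.last n) (K (Fin.last n))) ≠ 0 := by
  obtain ⟨E, hE, -⟩ := h.exists_transversalFactor_mul
  rw [← h.constantCoeff_transversalFactor]
  set b := subst (mapPt Q K) (pderiv ℂ (Sum.inr (Fin.last n)) Q') with hb
  -- Moving this unit into `E` leaves a right side that depends on `ζ` only.
  have hb1 : b * b⁻¹ = 1 :=
    MvPowerSeries.mul_inv_cancel b (by rw [h.constantCoeff_mapPt_pderiv_last]; exact one_ne_zero)
  refine constantCoeff_ne_zero_of_mul_eq_zetaIncl (E := E * b⁻¹)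
    (P := conjSeries (jacobian K).det) ?_ ?_ ?_
  · rw [← mul_assoc, hE, mul_assoc, hb1, mul_one, conjZeta_apply]
  · intro h0
    have h1 : (jacobian K).det = 0 := conjSeries_injective (h0.trans conjSeries_zero.symm)
    have h2 := h.subst_wZero_det_jacobian
    rw [h1, subst_of_zero hasSubst_wZero] at h2
    exact mul_ne_zero hdet hg h2.symm
  · rwa [h.subst_zetaZero_transversalFactor]

/-- With `G_w(z, 0) = 0` the Jacobian determinant vanishes on `w = 0`, so `u E = 0` at `τ = 0`. The
factor `E` survives: at `z = 0`, `τ = 0` it is the conjugate of `det ∂F/∂z(·, 0)`, evaluated in `χ`.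
-/
theorem subst_tauZero_transversalFactor_eq_zero (hdet : (restrictedJacobian K).det ≠ 0)
    (hg : subst wZero (pderiv ℂ (Fin.last n) (K (Fin.last n))) = 0) :
    subst tauZero (transversalFactor Q Q' K) = 0 := by
  obtain ⟨E, hE, hE0⟩ := h.exists_transversalFactor_mul
  have h1 := congrArg (subst (tauZero (n := n))) hE
  rw [subst_mul hasSubst_tauZero, subst_mul hasSubst_tauZero, conjZeta_apply,
    subst_tauZero_zetaIncl, ← conjSeries_subst_wZero, h.subst_wZero_det_jacobian, hg, mul_zero,
    conjSeries_zero, subst_of_zero hasSubst_chiIncl, zero_mul] at h1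
  refine (mul_eq_zero.mp h1).resolve_right fun h2 => hdet ?_
  have h3 := subst_zToZero_tauZero E
  rw [h2, subst_of_zero hasSubst_zToZero, hE0, conjZeta_apply, subst_tauZero_zetaIncl,
    ← conjSeries_subst_wZero, subst_wZero_det_submatrix] at h3
  have h4 := chiIncl_injective (h3.symm.trans (subst_of_zero hasSubst_chiIncl).symm)
  exact conjSeries_injective (h4.trans conjSeries_zero.symm)

omit h in
theorem det_chiIncl_ne_zero (hdet : (restrictedJacobian K).det ≠ 0) :
    (Matrix.of fun k j : Fin n => subst (chiIncl (n := n))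
      (conjSeries (subst wZero (pderiv ℂ j.castSucc (K k.castSucc))))).det ≠ 0 := by
  have h1 : (Matrix.of fun k j : Fin n => subst (chiIncl (n := n))
      (conjSeries (subst wZero (pderiv ℂ j.castSucc (K k.castSucc))))) =
      (restrictedJacobian K).map ((substAlgHom (hasSubst_chiIncl (n := n))).toRingHom.comp
        (MvPowerSeries.map (starRingEnd ℂ))) := by
    ext1 k j
    exact (substAlgHom_apply hasSubst_chiIncl _).symm
  rw [h1, ← RingHom.mapMatrix_apply, ← RingHom.map_det]
  intro h0
  have h2 : subst (chiIncl (n := n)) (conjSeries (restrictedJacobian K).det) = 0 :=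
    (substAlgHom_apply hasSubst_chiIncl _).symm.trans h0
  have h3 := chiIncl_injective (h2.trans (subst_of_zero hasSubst_chiIncl).symm)
  exact hdet (conjSeries_injective (h3.trans conjSeries_zero.symm))

/-- Specialize to `χ = 0`: there `Q` vanishes and the matrix becomes `∂F/∂z(z, 0)`. -/
theorem det_mapPtTauZero_inl_ne_zero (hdet : (restrictedJacobian K).det ≠ 0) :
    (Matrix.of fun i j : Fin n =>
      pderiv ℂ (Sum.inl j) (mapPtTauZero Q K (Sum.inl i))).det ≠ 0 := by
  intro h0
  have h1 := congrArg (substAlgHom (hasSubst_chiToZero (n := n))) h0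
  rw [AlgHom.map_det, map_zero] at h1
  refine hdet (Eq.trans (congrArg Matrix.det ?_) h1)
  ext1 i j
  rw [AlgHom.mapMatrix_apply, Matrix.map_apply, Matrix.of_apply, substAlgHom_apply,
    ← pderiv_subst_chiToZero, mapPtTauZero, Sum.elim_inl, subst_chiToZero_tauZero,
    subst_zetaZero_graphPt h.source, pderiv_subst_wZero]
  rfl

/-- The components `F̄(χ, 0)` do not involve `z`, so the Jacobian is block triangular with two
nonsingular diagonal blocks. -/
theorem mapPtTauZero_injective (hdet : (restrictedJacobian K).det ≠ 0)
    {f : MvPowerSeries (Fin n ⊕ Fin n) ℂ} (hf : subst (mapPtTauZero Q K) f = 0) : f = 0 := by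
  refine eq_zero_of_subst_eq_zero h.constantCoeff_mapPtTauZero (fun v hv => ?_) hf
  have hr : ∀ k : Fin n, mapPtTauZero Q K (Sum.inr k) =
      subst chiIncl (conjSeries (subst wZero (K k.castSucc))) := fun _ => rfl
  have h1 : (fun i => v (Sum.inl i)) = 0 := by
    refine eq_zero_of_vecMul_eq_zero (h.det_mapPtTauZero_inl_ne_zero hdet) fun j => ?_
    have := hv (Sum.inl j)
    rw [Fintype.sum_sum_type] at this
    simpa [hr, pderiv_inl_subst_chiIncl] using this
  have h2 : (fun i => v (Sum.inr i)) = 0 := by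
    refine eq_zero_of_vecMul_eq_zero (det_chiIncl_ne_zero hdet) fun j => ?_
    have := hv (Sum.inr j)
    have h1' : ∀ i, v (Sum.inl i) = 0 := congrFun h1
    rw [Fintype.sum_sum_type] at this
    simpa [hr, h1', pderiv_inr_subst_chiIncl, pderiv_conjSeries, pderiv_subst_wZero] using this
  funext k
  rcases k with i | i
  · exact congrFun h1 i
  · exact congrFun h2 i

/-- Once `u = 0` at `τ = 0`, nonsingularity of `F̄_χ(χ, 0)` annihilates each `Q'_{χ_k}` after
substitution, and injectivity annihilates it before. As `Q'(z', 0, 0) = 0`, nothing is left. -/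
theorem subst_tauZero_target_eq_zero (hdet : (restrictedJacobian K).det ≠ 0)
    (hg : subst wZero (pderiv ℂ (Fin.last n) (K (Fin.last n))) = 0) :
    subst tauZero Q' = 0 := by
  refine eq_zero_of_pderiv_inr_eq_zero ?_ fun k => h.mapPtTauZero_injective hdet ?_
  · rw [subst_chiToZero_tauZero, h.target.subst_zetaZero]
  · have hu := h.subst_tauZero_transversalFactor_eq_zero hdet hg
    refine congrFun (eq_zero_of_vecMul_eq_zero (det_chiIncl_ne_zero hdet)
      (v := fun k => subst (mapPtTauZero Q K) (pderiv ℂ (Sum.inr k) (subst tauZero Q')))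
      fun j => ?_) k
    have := h.transversalFactor_mul_pderiv_tauZero j
    rw [hu, zero_mul] at this
    exact this.symm

end IsNormalMap

/-- If `q(z, χ) = Q(z, χ, 0) ≠ 0`, then `f(z, q(z, χ)) = 0` only for `f = 0`. -/
theorem IsNormal.eq_zero_of_subst_graphPt {Q : MvPowerSeries (Fin n ⊕ Fin (n + 1)) ℂ}
    (hQ : IsNormal Q) (hq : subst tauZero Q ≠ 0) {f : MvPowerSeries (Fin (n + 1)) ℂ}
    (hf : subst tauZero (subst (graphPt Q) f) = 0) : f = 0 := by
  -- As `q(z, 0) = 0` and `q ≠ 0`, the series `q` depends on some `χ_k`. Its `χ_k`-derivative, with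
  -- the identity block in `z`, gives `(z, q)` full generic rank.
  obtain ⟨k, hk⟩ : ∃ k, pderiv ℂ (Sum.inr k) (subst tauZero Q) ≠ 0 := by
    by_contra hcon
    push Not at hcon
    exact hq (eq_zero_of_pderiv_inr_eq_zero
      (by rw [subst_chiToZero_tauZero, hQ.subst_zetaZero]) hcon)
  rw [subst_comp_subst_apply hQ.hasSubst_graphPt hasSubst_tauZero] at hf
  refine eq_zero_of_subst_eq_zero (fun i => ?_) (fun v hv => ?_) hf
  · rw [constantCoeff_subst_of_zero hasSubst_tauZero constantCoeff_tauZero,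
      hQ.constantCoeff_graphPt]
  · have h1 : v (Fin.last n) = 0 := by
      have := hv (Sum.inr k)
      rw [Fin.sum_univ_castSucc] at this
      simp only [graphPt_castSucc, graphPt_last, subst_X hasSubst_tauZero, tauZero_inl] at this
      simpa [hk] using this
    funext i
    refine Fin.lastCases h1 (fun i => ?_) i
    have := hv (Sum.inl i)
    rw [Fin.sum_univ_castSucc, h1] at this
    simpa [subst_X hasSubst_tauZero, pderiv_X, Pi.single_apply] using this

namespace IsNormalMap

variable {Q Q' : MvPowerSeries (Fin n ⊕ Fin (n + 1)) ℂ}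
  {K : Fin (n + 1) → MvPowerSeries (Fin (n + 1)) ℂ} (h : IsNormalMap Q Q' K)
include h

/-- A map of a hypersurface of finite type which is not totally degenerate is transversal, if it
is not transversally flat or if the target is of finite type. -/
theorem constantCoeff_pderiv_last_ne_zero_of_finiteType (hq : subst tauZero Q ≠ 0)
    (hdet : (restrictedJacobian K).det ≠ 0)
    (hne : subst tauZero Q' ≠ 0 ∨ K (Fin.last n) ≠ 0) :
    constantCoeff (pderiv ℂ (Fin.last n) (K (Fin.last n))) ≠ 0 := by
  refine h.constantCoeff_pderiv_last_ne_zero hdet fun hg => ?_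
  have hQ' := h.subst_tauZero_target_eq_zero hdet hg
  refine hne.elim (fun h1 => h1 hQ') fun h1 => h1 (h.source.eq_zero_of_subst_graphPt hq ?_)
  rw [h.basic_tauZero, hQ', subst_of_zero h.hasSubst_mapPtTauZero]

end IsNormalMap

end

/-! ### Complexified maps, their linear parts, and CR-transversality. -/

namespace FormalMap

variable {N : ℕ}

theorem hasSubst (H : FormalMap N) : HasSubst H.toFun := hasSubst_zero_coeff H.zero

/-- The composition `K ∘ H`. -/
def comp (K H : FormalMap N) : FormalMap N where
  toFun := K.compFun H
  zero i := by rw [compFun, constantCoeff_subst_of_zero H.hasSubst H.zero, K.zero]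

/-- The identity map. -/
def id (N : ℕ) : FormalMap N where
  toFun := X
  zero i := by simp

theorem hasSubst_inl : HasSubst (fun j => (X (Sum.inl j) : MvPowerSeries (Fin N ⊕ Fin N) ℂ)) :=
  hasSubst_zero_coeff fun j => by simp

theorem hasSubst_inr : HasSubst (fun j => (X (Sum.inr j) : MvPowerSeries (Fin N ⊕ Fin N) ℂ)) :=
  hasSubst_zero_coeff fun j => by simp

theorem constantCoeff_complexify (H : FormalMap N) (k : Fin N ⊕ Fin N) :
    constantCoeff (H.complexify k) = 0 := by
  rcases k with i | i
  · rw [complexify, Sum.elim_inl, constantCoeff_subst_of_zero hasSubst_inl (fun j => by simp),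
      H.zero]
  · rw [complexify, Sum.elim_inr, constantCoeff_subst_of_zero hasSubst_inr (fun j => by simp),
      constantCoeff_conjSeries, H.zero, map_zero]

theorem hasSubst_complexify (H : FormalMap N) : HasSubst H.complexify :=
  hasSubst_zero_coeff H.constantCoeff_complexify

theorem hasSubst_conj (H : FormalMap N) : HasSubst fun j => conjSeries (H.toFun j) :=
  hasSubst_zero_coeff fun i => by rw [constantCoeff_conjSeries, H.zero, map_zero]

theorem complexify_comp (K H : FormalMap N) (k : Fin N ⊕ Fin N) :
    (K.comp H).complexify k = subst H.complexify (K.complexify k) := by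
  rcases k with i | i
  · change subst (fun j => X (Sum.inl j)) (subst H.toFun (K.toFun i)) =
      subst H.complexify (subst (fun j => X (Sum.inl j)) (K.toFun i))
    rw [subst_comp_subst_apply H.hasSubst hasSubst_inl,
      subst_comp_subst_apply hasSubst_inl H.hasSubst_complexify]
    congr 1
    funext j
    rw [subst_X H.hasSubst_complexify, complexify, Sum.elim_inl]
  · change subst (fun j => X (Sum.inr j)) (conjSeries (subst H.toFun (K.toFun i))) =
      subst H.complexify (subst (fun j => X (Sum.inr j)) (conjSeries (K.toFun i)))
    rw [conjSeries_subst H.hasSubst, subst_comp_subst_apply H.hasSubst_conj hasSubst_inr,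
      subst_comp_subst_apply hasSubst_inr H.hasSubst_complexify]
    congr 1
    funext j
    rw [subst_X H.hasSubst_complexify, complexify, Sum.elim_inr]

theorem subst_complexify_comp (K H : FormalMap N) (f : MvPowerSeries (Fin N ⊕ Fin N) ℂ) :
    subst H.complexify (subst K.complexify f) = subst (K.comp H).complexify f := by
  rw [subst_comp_subst_apply K.hasSubst_complexify H.hasSubst_complexify]
  congr 1
  funext k
  rw [complexify_comp]

theorem subst_complexify_of_eq_X {H : FormalMap N} (hH : H.toFun = X)
    (f : MvPowerSeries (Fin N ⊕ Fin N) ℂ) : subst H.complexify f = f := by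
  have : H.complexify = X := by
    funext k
    rcases k with i | i
    · rw [complexify, Sum.elim_inl, hH, subst_X hasSubst_inl]
    · rw [complexify, Sum.elim_inr, hH, conjSeries_X, subst_X hasSubst_inr]
  rw [this, subst_self]
  rfl

/-- The coefficients of `dZ` in the linear part of a series in `(Z, ζ)`. -/
def zRow (f : MvPowerSeries (Fin N ⊕ Fin N) ℂ) : Fin N → ℂ :=
  fun j => coeff (Finsupp.single (Sum.inl j) 1) f

theorem zRow_mul (f g : MvPowerSeries (Fin N ⊕ Fin N) ℂ) (hg : constantCoeff g = 0) :
    zRow (f * g) = constantCoeff f • zRow g := by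
  funext j
  simp only [zRow, Pi.smul_apply, smul_eq_mul, coeff_single_eq_constantCoeff_pderiv,
    Derivation.leibniz, map_add, map_mul, hg, zero_mul, add_zero]

/-- The components `H̄(ζ)` do not involve `Z`, so only `dH(0)` acts on the row. -/
theorem zRow_subst_complexify (H : FormalMap N) (f : MvPowerSeries (Fin N ⊕ Fin N) ℂ) :
    zRow (subst H.complexify f) =
      Matrix.vecMul (zRow f) (Matrix.of fun i j => coeff (Finsupp.single j 1) (H.toFun i)) := by
  classical
  funext j
  have hl : ∀ i, coeff (Finsupp.single (Sum.inl j) 1) (H.complexify (Sum.inl i)) =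
      coeff (Finsupp.single j 1) (H.toFun i) := by
    intro i
    rw [complexify, Sum.elim_inl, coeff_single_subst (fun j => by simp)]
    simp [coeff_X, Finsupp.single_left_inj]
  have hr : ∀ i, coeff (Finsupp.single (Sum.inl j) 1) (H.complexify (Sum.inr i)) = 0 := by
    intro i
    rw [complexify, Sum.elim_inr, coeff_single_subst (fun j => by simp)]
    simp [coeff_X, Finsupp.single_left_inj]
  rw [zRow, coeff_single_subst H.constantCoeff_complexify, Fintype.sum_sum_type]
  simp [hl, hr, Matrix.vecMul, dotProduct, zRow]

end FormalMap

open FormalMap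

theorem FormalHypersurface.gradientForm_apply {N : ℕ} (M : FormalHypersurface N)
    (x : Fin N → ℂ) : M.gradientForm x = zRow M.r ⬝ᵥ x := by
  simp [gradientForm, zRow, dotProduct]

/-- A hyperplane and a subspace span the whole space exactly when the subspace is not contained in
the hyperplane, that is, when the form `∂_Z r'(0) ∘ dH` is nonzero. -/
theorem crTransversal_iff_zRow_ne_zero {N : ℕ} (H : FormalMap N) (M' : FormalHypersurface N) :
    CRTransversal H M' ↔ zRow (subst H.complexify M'.r) ≠ 0 := by
  have hrow : ∀ x, M'.gradientForm (H.differential x) =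
      zRow (subst H.complexify M'.r) ⬝ᵥ x := by
    intro x
    rw [M'.gradientForm_apply, zRow_subst_complexify, differential, Matrix.toLin'_apply,
      Matrix.dotProduct_mulVec]
  constructor
  · intro hT h0
    obtain ⟨j, hj⟩ := M'.gradient
    have hle : LinearMap.range H.differential ≤ M'.tangent10 := by
      rintro _ ⟨x, rfl⟩
      rw [FormalHypersurface.tangent10, LinearMap.mem_ker, hrow, h0, zero_dotProduct]
    rw [CRTransversal, sup_eq_left.mpr hle] at hT
    have : Pi.single j 1 ∈ M'.tangent10 := hT ▸ Submodule.mem_top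
    rw [FormalHypersurface.tangent10, LinearMap.mem_ker, M'.gradientForm_apply] at this
    simp only [dotProduct_single, mul_one] at this
    exact hj this
  · intro hne
    obtain ⟨j, hj⟩ := Function.ne_iff.mp hne
    have hj' : M'.gradientForm (H.differential (Pi.single j 1)) ≠ 0 := by
      rw [hrow]
      simpa using hj
    rw [CRTransversal, eq_top_iff]
    intro y _
    set x := H.differential (Pi.single j 1)
    set t := M'.gradientForm y / M'.gradientForm x
    have hy : y = (y - t • x) + t • x := by abel
    rw [hy]
    refine Submodule.add_mem_sup ?_ (Submodule.smul_mem _ _ ⟨_, rfl⟩)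
    rw [FormalHypersurface.tangent10, LinearMap.mem_ker, map_sub, map_smul, smul_eq_mul,
      div_mul_cancel₀ _ hj', sub_self]

namespace FormalCoordChange

variable {N : ℕ} (c : FormalCoordChange N)

theorem subst_inv_subst_map (f : MvPowerSeries (Fin N ⊕ Fin N) ℂ) :
    subst c.inv.complexify (subst c.map.complexify f) = f := by
  rw [subst_complexify_comp]
  exact subst_complexify_of_eq_X c.map_inv f

theorem zRow_subst_map_eq_zero_iff (f : MvPowerSeries (Fin N ⊕ Fin N) ℂ) :
    zRow (subst c.map.complexify f) = 0 ↔ zRow f = 0 := by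
  constructor
  · intro h
    rw [← c.subst_inv_subst_map f, zRow_subst_complexify, h, Matrix.zero_vecMul]
  · intro h
    rw [zRow_subst_complexify, h, Matrix.zero_vecMul]

end FormalCoordChange

/-! ### Restriction to the graph `w = Q(z, χ, τ)`. -/

section Graph

variable {n : ℕ}

theorem hasSubst_graphVars : HasSubst (fun k => (X (Sum.map Fin.castSucc _root_.id k) :
    MvPowerSeries (Fin (n + 1) ⊕ Fin (n + 1)) ℂ) : Fin n ⊕ Fin (n + 1) → _) :=
  hasSubst_zero_coeff fun k => by simp

theorem constantCoeff_graphSeries {Q : MvPowerSeries (Fin n ⊕ Fin (n + 1)) ℂ} (hQ : IsNormal Q) :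
    constantCoeff (graphSeries Q) = 0 := by
  rw [graphSeries, map_sub, constantCoeff_subst_of_zero hasSubst_graphVars (fun k => by simp),
    hQ.constantCoeff_eq_zero]
  simp

theorem zRow_graphSeries {Q : MvPowerSeries (Fin n ⊕ Fin (n + 1)) ℂ} (hQ : IsNormal Q) :
    zRow (graphSeries Q) = Pi.single (Fin.last n) 1 := by
  classical
  have hz : ∀ i : Fin n, coeff (Finsupp.single (Sum.inl i) 1) Q = 0 := fun i => by
    rw [coeff_single_eq_constantCoeff_pderiv,
      ← constantCoeff_subst_of_zero hasSubst_zetaZero constantCoeff_zetaZero,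
      hQ.subst_zetaZero_pderiv_inl, map_zero]
  funext j
  rw [zRow, graphSeries, map_sub, coeff_single_subst (fun k => by simp), Fintype.sum_sum_type]
  simp [hz, coeff_X, Finsupp.single_left_inj, Pi.single_apply]

/-- The substitution `((z, w), (χ, τ)) = ((z, Q(z, χ, τ)), (χ, τ))`. -/
def graphSubst (Q : MvPowerSeries (Fin n ⊕ Fin (n + 1)) ℂ) :
    Fin (n + 1) ⊕ Fin (n + 1) → MvPowerSeries (Fin n ⊕ Fin (n + 1)) ℂ :=
  Sum.elim (graphPt Q) zetaIncl

theorem hasSubst_graphSubst {Q : MvPowerSeries (Fin n ⊕ Fin (n + 1)) ℂ} (hQ : IsNormal Q) :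
    HasSubst (graphSubst Q) :=
  hasSubst_zero_coeff fun k => by
    rcases k with i | j
    · exact hQ.constantCoeff_graphPt i
    · exact constantCoeff_zetaIncl j

theorem subst_graphSubst_graphSeries {Q : MvPowerSeries (Fin n ⊕ Fin (n + 1)) ℂ}
    (hQ : IsNormal Q) : subst (graphSubst Q) (graphSeries Q) = 0 := by
  rw [graphSeries, subst_sub (hasSubst_graphSubst hQ), subst_X (hasSubst_graphSubst hQ),
    subst_comp_subst_apply hasSubst_graphVars (hasSubst_graphSubst hQ)]
  have : (fun k => subst (graphSubst Q) (X (Sum.map Fin.castSucc _root_.id k) :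
      MvPowerSeries (Fin (n + 1) ⊕ Fin (n + 1)) ℂ)) = X := by
    funext k
    rw [subst_X (hasSubst_graphSubst hQ)]
    rcases k with i | j
    · simp [graphSubst]
    · simp [graphSubst]
  rw [this, subst_self, graphSubst, Sum.elim_inl, graphPt_last, _root_.id, sub_self]

/-- Turns vanishing of the pulled-back equation on the graph into the basic identity. -/
theorem subst_graphSubst_complexify {Q Q' : MvPowerSeries (Fin n ⊕ Fin (n + 1)) ℂ}
    (hQ : IsNormal Q) (K : FormalMap (n + 1)) :
    subst (graphSubst Q) (subst K.complexify (graphSeries Q')) =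
      subst (graphPt Q) (K.toFun (Fin.last n)) - subst (mapPt Q K.toFun) Q' := by
  have hΘ := hasSubst_graphSubst hQ
  have hl : ∀ i, subst (graphSubst Q) (K.complexify (Sum.inl i)) =
      subst (graphPt Q) (K.toFun i) := fun i => by
    rw [complexify, Sum.elim_inl, subst_comp_subst_apply hasSubst_inl hΘ]
    congr 1
    funext j
    rw [subst_X hΘ, graphSubst, Sum.elim_inl]
  have hr : ∀ i, subst (graphSubst Q) (K.complexify (Sum.inr i)) =
      subst zetaIncl (conjSeries (K.toFun i)) := fun i => by
    rw [complexify, Sum.elim_inr, subst_comp_subst_apply hasSubst_inr hΘ]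
    congr 1
    funext j
    rw [subst_X hΘ, graphSubst, Sum.elim_inr]
  rw [graphSeries, subst_sub K.hasSubst_complexify, subst_sub hΘ, subst_X K.hasSubst_complexify,
    hl, subst_comp_subst_apply hasSubst_graphVars K.hasSubst_complexify,
    subst_comp_subst_apply (hasSubst_zero_coeff fun k => ?_) hΘ]
  · congr 2
    funext k
    rw [subst_X K.hasSubst_complexify]
    rcases k with i | j
    · exact hl _
    · exact hr _
  · rw [subst_X K.hasSubst_complexify, K.constantCoeff_complexify]

end Graph

/-! ### Geometric hypotheses expressed in normal coordinates. -/

namespace NormalCoordinates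

variable {n : ℕ} {M M' : FormalHypersurface (n + 1)}

theorem isNormal (c : NormalCoordinates M) : IsNormal c.Q := ⟨c.normal_z, c.normal_chi⟩

/-- The map `H` in normal coordinates, as a formal map. -/
def expressMap (c : NormalCoordinates M) (c' : NormalCoordinates M') (H : FormalMap (n + 1)) :
    FormalMap (n + 1) :=
  (c'.change.inv.comp H).comp c.change.map

theorem expressMap_toFun (c : NormalCoordinates M) (c' : NormalCoordinates M')
    (H : FormalMap (n + 1)) : (expressMap c c' H).toFun = express c c' H := rfl

theorem exists_eq_mul_graphSeries (c : NormalCoordinates M) :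
    ∃ b, subst c.change.map.complexify M.r = b * graphSeries c.Q := by
  have : subst c.change.map.complexify M.r ∈ Ideal.span {graphSeries c.Q} :=
    c.defines ▸ Ideal.mem_span_singleton_self _
  obtain ⟨b, hb⟩ := Ideal.mem_span_singleton'.mp this
  exact ⟨b, hb.symm⟩

theorem exists_mul_eq_graphSeries (c : NormalCoordinates M) :
    ∃ a, graphSeries c.Q = a * subst c.change.map.complexify M.r := by
  have : graphSeries c.Q ∈ Ideal.span {subst c.change.map.complexify M.r} :=
    c.defines ▸ Ideal.mem_span_singleton_self _
  obtain ⟨b, hb⟩ := Ideal.mem_span_singleton'.mp this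
  exact ⟨b, hb.symm⟩

theorem isNormalMap (c : NormalCoordinates M) (c' : NormalCoordinates M') {H : FormalMap (n + 1)}
    (hH : SendsInto H M M') : IsNormalMap c.Q c'.Q (express c c' H) where
  source := c.isNormal
  target := c'.isNormal
  zero := (expressMap c c' H).zero
  basic := by
    rw [← sub_eq_zero, ← expressMap_toFun, ← subst_graphSubst_complexify c.isNormal]
    obtain ⟨a, ha⟩ := c'.exists_mul_eq_graphSeries
    obtain ⟨b, hb⟩ := c.exists_eq_mul_graphSeries
    obtain ⟨d, hd⟩ := Ideal.mem_span_singleton'.mp (hH M'.r (Ideal.mem_span_singleton_self _))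
    -- Up to factors, `w' - Q'` pulls back successively to `r'`, to `r`, and to `w - Q`, which
    -- vanishes on the graph.
    rw [expressMap, ← subst_complexify_comp, ← subst_complexify_comp, ha,
      subst_mul c'.change.inv.hasSubst_complexify, c'.change.subst_inv_subst_map,
      subst_mul H.hasSubst_complexify, ← hd, ← mul_assoc,
      subst_mul c.change.map.hasSubst_complexify, hb, ← mul_assoc,
      subst_mul (hasSubst_graphSubst c.isNormal), subst_graphSubst_graphSeries c.isNormal, mul_zero]

theorem sendsInto_id (M : FormalHypersurface (n + 1)) : SendsInto (FormalMap.id (n + 1)) M M :=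
  fun h hh => by rwa [subst_complexify_of_eq_X rfl]

/-- The identity of `M` read in two normal coordinate systems is the transition map, so the theory
of maps applies to changes of coordinates. -/
theorem subst_express (c₁ : NormalCoordinates M) (c₂ : NormalCoordinates M)
    (c' : NormalCoordinates M') (H : FormalMap (n + 1)) (i : Fin (n + 1)) :
    subst (express c₁ c₂ (FormalMap.id (n + 1))) (express c₂ c' H i) = express c₁ c' H i := by
  have hΦ : HasSubst (express c₁ c₂ (FormalMap.id (n + 1))) :=
    (expressMap c₁ c₂ (FormalMap.id (n + 1))).hasSubst
  have key : ∀ j, subst (express c₁ c₂ (FormalMap.id (n + 1))) (c₂.change.map.toFun j) =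
      c₁.change.map.toFun j := by
    intro j
    have h1 : express c₁ c₂ (FormalMap.id (n + 1)) =
        fun i => subst c₁.change.map.toFun (c₂.change.inv.toFun i) := by
      funext i
      rw [express]
      congr 1
      exact congrFun subst_self _
    rw [h1, ← subst_comp_subst_apply c₂.change.inv.hasSubst c₁.change.map.hasSubst]
    have h2 : subst c₂.change.inv.toFun (c₂.change.map.toFun j) = X j :=
      congrFun c₂.change.map_inv j
    rw [h2, subst_X c₁.change.map.hasSubst]
  rw [express, subst_comp_subst_apply c₂.change.map.hasSubst hΦ]
  simp only [key]
  rfl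

theorem express_self (c : NormalCoordinates M) : express c c (FormalMap.id (n + 1)) = X := by
  funext i
  rw [express]
  have h1 : subst (FormalMap.id (n + 1)).toFun (c.change.inv.toFun i) = c.change.inv.toFun i :=
    congrFun subst_self _
  rw [h1]
  exact congrFun c.change.inv_map i

/-- Transversality is the condition `G_w(0) ≠ 0` in normal coordinates. -/
theorem crTransversal_iff (c : NormalCoordinates M) (c' : NormalCoordinates M')
    {H : FormalMap (n + 1)} (hH : SendsInto H M M') :
    CRTransversal H M' ↔
      constantCoeff (pderiv ℂ (Fin.last n) (express c c' H (Fin.last n))) ≠ 0 := by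
  have h := c.isNormalMap c' hH
  obtain ⟨b, hb⟩ := c'.exists_eq_mul_graphSeries
  obtain ⟨a, ha⟩ := c'.exists_mul_eq_graphSeries
  have hg0 := constantCoeff_graphSeries c'.isNormal
  -- If `b(0) = 0`, the `dZ` row of `b (w' - Q')` is zero, hence so is that of its multiple `w' -
  -- Q'`; but that row is `dw'`.
  have hb0 : constantCoeff b ≠ 0 := by
    intro h0
    have h1 := zRow_mul b (graphSeries c'.Q) hg0
    rw [← hb, h0, zero_smul] at h1
    have h2 := zRow_graphSeries c'.isNormal
    rw [ha, zRow_mul _ _ (by rw [hb, map_mul, hg0, mul_zero]), h1, smul_zero] at h2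
    simpa using congrFun h2 (Fin.last n)
  have hrow : zRow (subst c.change.map.complexify (subst H.complexify M'.r)) =
      constantCoeff b • fun j => coeff (Finsupp.single j 1) (express c c' H (Fin.last n)) := by
    have h1 : subst c.change.map.complexify (subst H.complexify M'.r) =
        subst (expressMap c c' H).complexify (b * graphSeries c'.Q) := by
      rw [← hb, expressMap, ← subst_complexify_comp, ← subst_complexify_comp,
        c'.change.subst_inv_subst_map]
    rw [h1, zRow_subst_complexify, zRow_mul _ _ hg0, zRow_graphSeries c'.isNormal,
      Matrix.smul_vecMul, Matrix.single_one_vecMul, expressMap_toFun]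
    rfl
  rw [crTransversal_iff_zRow_ne_zero, ← not_iff_not, not_not, not_not,
    ← c.change.zRow_subst_map_eq_zero_iff, hrow, smul_eq_zero, or_iff_right hb0]
  constructor
  · intro h0
    rw [← coeff_single_eq_constantCoeff_pderiv]
    exact congrFun h0 (Fin.last n)
  · intro h0
    funext j
    rw [coeff_single_eq_constantCoeff_pderiv]
    refine Fin.lastCases h0 (fun i => ?_) j
    rw [Pi.zero_apply, ← constantCoeff_subst_of_zero hasSubst_wZero constantCoeff_wZero,
      h.subst_wZero_pderiv_last, map_zero]

end NormalCoordinates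

/-! ### Composition and independence of the normal coordinates. -/

section Composition

variable {n : ℕ} {τ : Type*}

/-- Substitution of a family whose last component vanishes. -/
theorem subst_of_last_eq_zero {a : Fin (n + 1) → MvPowerSeries τ ℂ}
    (h0 : ∀ i, constantCoeff (a i) = 0) (hlast : a (Fin.last n) = 0)
    (f : MvPowerSeries (Fin (n + 1)) ℂ) :
    subst a f = subst (fun i : Fin n => a i.castSucc) (subst wZero f) := by
  have ha : HasSubst fun i : Fin n => a i.castSucc := hasSubst_zero_coeff fun i => h0 _
  rw [subst_comp_subst_apply hasSubst_wZero ha]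
  congr 1
  funext i
  refine Fin.lastCases ?_ (fun i => ?_) i
  · rw [wZero_last, subst_of_zero ha, hlast]
  · rw [wZero_castSucc, subst_X ha]

variable {Φ : Fin (n + 1) → MvPowerSeries (Fin (n + 1)) ℂ}
  (h0 : ∀ i, constantCoeff (Φ i) = 0) (hlast : subst wZero (Φ (Fin.last n)) = 0)
include h0 hlast

theorem subst_wZero_subst (f : MvPowerSeries (Fin (n + 1)) ℂ) :
    subst wZero (subst Φ f) =
      subst (fun i : Fin n => subst (wZero (n := n)) (Φ i.castSucc)) (subst wZero f) := by
  have hΦ : HasSubst Φ := hasSubst_zero_coeff h0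
  rw [subst_comp_subst_apply hΦ hasSubst_wZero]
  refine subst_of_last_eq_zero (fun i => ?_) hlast f
  rw [constantCoeff_subst_of_zero hasSubst_wZero constantCoeff_wZero, h0]

/-- `Φ` preserves `w = 0`, so its last component has no `z`-derivative there and the chain rule
closes up on the `n × n` blocks. -/
theorem det_restrictedJacobian_comp (K : Fin (n + 1) → MvPowerSeries (Fin (n + 1)) ℂ) :
    (restrictedJacobian fun i => subst Φ (K i)).det =
      subst (fun i : Fin n => subst (wZero (n := n)) (Φ i.castSucc))
        (restrictedJacobian K).det * (restrictedJacobian Φ).det := by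
  have hΦ : HasSubst Φ := hasSubst_zero_coeff h0
  have hφ : HasSubst fun i : Fin n => subst (wZero (n := n)) (Φ i.castSucc) :=
    hasSubst_zero_coeff fun i => by
      rw [constantCoeff_subst_of_zero hasSubst_wZero constantCoeff_wZero, h0]
  rw [← substAlgHom_apply hφ, AlgHom.map_det, ← Matrix.det_mul]
  congr 1
  ext1 i j
  rw [Matrix.mul_apply, restrictedJacobian, Matrix.of_apply, pderiv_subst hΦ,
    Fin.sum_univ_castSucc, subst_add hasSubst_wZero, subst_mul hasSubst_wZero,
    ← pderiv_subst_wZero (Φ (Fin.last n)), hlast, map_zero, mul_zero, add_zero,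
    ← substAlgHom_apply hasSubst_wZero, map_sum]
  refine Finset.sum_congr rfl fun k _ => ?_
  rw [substAlgHom_apply, subst_mul hasSubst_wZero, subst_wZero_subst h0 hlast,
    AlgHom.mapMatrix_apply, Matrix.map_apply, substAlgHom_apply]
  rfl

end Composition

theorem restrictedJacobian_X {n : ℕ} :
    restrictedJacobian (X : Fin (n + 1) → MvPowerSeries (Fin (n + 1)) ℂ) = 1 := by
  ext1 i j
  rw [restrictedJacobian, Matrix.of_apply, pderiv_X, Matrix.one_apply, Pi.single_apply,
    ← substAlgHom_apply hasSubst_wZero]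
  split_ifs with h1 h2 h2
  · rw [map_one]
  · exact absurd (Fin.castSucc_injective _ h1) h2
  · exact absurd (congrArg Fin.castSucc h2) h1
  · rw [map_zero]

namespace NormalCoordinates

variable {n : ℕ} {M M' : FormalHypersurface (n + 1)}

theorem notTotallyDegenerate_iff (c : NormalCoordinates M) (c' : NormalCoordinates M')
    (H : FormalMap (n + 1)) :
    c.NotTotallyDegenerate c' H ↔ (restrictedJacobian (express c c' H)).det ≠ 0 :=
  rank_eq_card_iff_det_ne_zero (restrictedJacobian (express c c' H))

theorem finiteType_iff (c : NormalCoordinates M) : c.FiniteType ↔ subst tauZero c.Q ≠ 0 :=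
  Iff.rfl

/-- Non-degeneracy does not depend on the normal coordinates in the source. -/
theorem NotTotallyDegenerate.change_source {c₁ : NormalCoordinates M} {c' : NormalCoordinates M'}
    {H : FormalMap (n + 1)} (h : c₁.NotTotallyDegenerate c' H) (c₂ : NormalCoordinates M) :
    c₂.NotTotallyDegenerate c' H := by
  rw [notTotallyDegenerate_iff] at h ⊢
  have h21 := c₂.isNormalMap c₁ (sendsInto_id M)
  have h12 := c₁.isNormalMap c₂ (sendsInto_id M)
  set Φ := express c₂ c₁ (FormalMap.id (n + 1))
  set Ψ := express c₁ c₂ (FormalMap.id (n + 1))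
  have e1 : express c₂ c' H = fun i => subst Φ (express c₁ c' H i) :=
    funext fun i => (subst_express c₂ c₁ c' H i).symm
  have e2 : (fun i => subst Φ (Ψ i)) = X := by
    rw [← express_self c₂]
    exact funext fun i => subst_express c₂ c₁ c₂ _ i
  have e3 : (fun i => subst Ψ (Φ i)) = X := by
    rw [← express_self c₁]
    exact funext fun i => subst_express c₁ c₂ c₁ _ i
  have d2 := det_restrictedJacobian_comp h21.zero h21.subst_wZero_last Ψ
  rw [e2, restrictedJacobian_X, Matrix.det_one] at d2
  rw [e1, det_restrictedJacobian_comp h21.zero h21.subst_wZero_last]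
  -- The first factor is a nonzero series composed with the restriction of `Φ`, which `Ψ` inverts;
  -- the second divides the determinant `1` of `Ψ ∘ Φ = id`.
  refine mul_ne_zero (fun h0 => h ?_) (fun h0 => ?_)
  · have hφ : HasSubst fun i : Fin n => subst (wZero (n := n)) (Φ i.castSucc) :=
      hasSubst_zero_coeff fun i => by
        rw [constantCoeff_subst_of_zero hasSubst_wZero constantCoeff_wZero, h21.zero]
    have hψ : HasSubst fun i : Fin n => subst (wZero (n := n)) (Ψ i.castSucc) :=
      hasSubst_zero_coeff fun i => by
        rw [constantCoeff_subst_of_zero hasSubst_wZero constantCoeff_wZero, h12.zero]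
    have h1 := congrArg (subst fun i : Fin n => subst (wZero (n := n)) (Ψ i.castSucc)) h0
    rw [subst_of_zero hψ, subst_comp_subst_apply hφ hψ] at h1
    have h2 : (fun i : Fin n => subst (fun i : Fin n => subst (wZero (n := n)) (Ψ i.castSucc))
        (subst (wZero (n := n)) (Φ i.castSucc))) = X := by
      funext i
      rw [← subst_wZero_subst h12.zero h12.subst_wZero_last, congrFun e3 i.castSucc,
        subst_X hasSubst_wZero, wZero_castSucc]
    rwa [h2, subst_self] at h1
  · rw [h0, mul_zero] at d2
    exact one_ne_zero d2

/-- Finite type does not depend on the normal coordinates. -/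
theorem FiniteType.change {c₁ : NormalCoordinates M} (h : c₁.FiniteType)
    (c₂ : NormalCoordinates M) : c₂.FiniteType := by
  rw [finiteType_iff] at h ⊢
  have h12 := c₁.isNormalMap c₂ (sendsInto_id M)
  have h21 := c₂.isNormalMap c₁ (sendsInto_id M)
  set Φ := express c₂ c₁ (FormalMap.id (n + 1)) with hΦ
  set Ψ := express c₁ c₂ (FormalMap.id (n + 1)) with hΨ
  intro h0
  have e3 : subst Ψ (Φ (Fin.last n)) = X (Fin.last n) := by
    rw [hΨ, hΦ, subst_express, express_self]
  -- If `Q₂(z, χ, 0) = 0`, the last component of `Ψ` vanishes at `(z, Q₁(z, χ, 0))`. Applying `Φ`,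
  -- whose last component vanishes on `w = 0`, gives `Q₁(z, χ, 0) = 0`.
  have hb := h12.basic_tauZero
  rw [h0, subst_of_zero h12.hasSubst_mapPtTauZero] at hb
  have hΨs : HasSubst Ψ := hasSubst_zero_coeff h12.zero
  have e4 : subst (tauZero (n := n)) (subst (graphPt c₁.Q) (subst Ψ (Φ (Fin.last n)))) =
      subst tauZero (subst (graphPt c₁.Q) (X (Fin.last n) : MvPowerSeries (Fin (n + 1)) ℂ)) := by
    rw [e3]
  have hgz : ∀ s, constantCoeff (subst (graphPt c₁.Q) (Ψ s)) = 0 := fun i => by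
    rw [constantCoeff_subst_of_zero h12.source.hasSubst_graphPt h12.source.constantCoeff_graphPt,
      h12.zero]
  have htz : ∀ s, constantCoeff (subst (tauZero (n := n)) (subst (graphPt c₁.Q) (Ψ s))) = 0 :=
    fun i => by
      rw [constantCoeff_subst_of_zero hasSubst_tauZero constantCoeff_tauZero, hgz]
  rw [subst_X h12.source.hasSubst_graphPt, graphPt_last,
    subst_comp_subst_apply hΨs h12.source.hasSubst_graphPt,
    subst_comp_subst_apply (hasSubst_zero_coeff hgz) hasSubst_tauZero,
    subst_of_last_eq_zero htz hb, h21.subst_wZero_last,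
    subst_of_zero (hasSubst_zero_coeff fun i => htz _)] at e4
  exact h e4.symm

theorem zDeriv_eq (c : NormalCoordinates M) (α : Fin n →₀ ℕ) :
    c.zDeriv α = C ((∏ i, (α i).factorial : ℕ) : ℂ) * zPart α (subst tauZero c.Q) := by
  ext β
  rw [coeff_C_mul, coeff_zPart, coeff_subst_of_partialInv hasSubst_tauZero
    (Sum.map _root_.id Fin.castSucc)
    (Function.Injective.sumMap Function.injective_id (Fin.castSucc_injective n)) ?_ ?_]
  · refine congrArg (fun d => _ * coeff d c.Q) (Finsupp.ext fun k => ?_)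
    have hinj : Function.Injective
        (Sum.map _root_.id Fin.castSucc : Fin n ⊕ Fin n → Fin n ⊕ Fin (n + 1)) :=
      Function.Injective.sumMap Function.injective_id (Fin.castSucc_injective n)
    rcases k with i | j
    · exact (Finsupp.mapDomain_apply hinj (Finsupp.sumElim α β) (Sum.inl i)).symm
    · rw [Finsupp.sumElim_inr]
      induction j using Fin.lastCases with
      | last =>
        rw [Finsupp.mapDomain_of_notMem_range, Finsupp.mapDomain_of_notMem_range]
        · rintro ⟨i | i, hi⟩
          · exact Sum.inl_ne_inr hi
          · exact (Fin.castSucc_lt_last i).ne (Sum.inr_injective hi)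
        · rintro ⟨i, hi⟩
          exact (Fin.castSucc_lt_last i).ne hi
      | cast i =>
        rw [Finsupp.mapDomain_apply (Fin.castSucc_injective n)]
        exact (Finsupp.mapDomain_apply hinj (Finsupp.sumElim α β) (Sum.inr i)).symm
  · rintro (i | i) <;> simp
  · rintro (i | j) hs
    · exact absurd ⟨Sum.inl i, rfl⟩ hs
    · refine Fin.lastCases ?_ (fun i hs => ?_) j hs
      · intro _
        exact tauZero_inr_last
      · exact absurd ⟨Sum.inr i, rfl⟩ hs

/-- A single `k` of full generic rank suffices; the factorials in `zDeriv` are constants and pass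
through the derivatives. -/
theorem ClassC.eq_zero {c : NormalCoordinates M} (hc : c.ClassC)
    (v : Fin n → MvPowerSeries (Fin n) ℂ)
    (hv : ∀ α, ∑ j, pderiv ℂ j (zPart α (subst tauZero c.Q)) * v j = 0) : v = 0 := by
  obtain ⟨k, hk⟩ := hc.exists
  refine (rank_eq_card_iff_injective _).mp hk v (funext fun α => ?_)
  simp only [Matrix.mulVec, dotProduct, Matrix.of_apply, zDeriv_eq, Derivation.leibniz, pderiv_C,
    add_zero, smul_eq_mul, mul_assoc, ← Finset.mul_sum, hv, mul_zero, Pi.zero_apply]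

/-- If `Q(z, χ, 0) = 0`, every vector lies in the kernel, including `(1, …, 1)`, which is nonzero
because `n ≥ 1`. -/
theorem ClassC.finiteType {c : NormalCoordinates M} (hc : c.ClassC) (hn : 1 ≤ n) :
    c.FiniteType := by
  rw [finiteType_iff]
  intro h0
  have h1 := hc.eq_zero (fun _ => 1) fun α => by simp [h0, zPart_zero]
  exact one_ne_zero (congrFun h1 ⟨0, hn⟩)

end NormalCoordinates

end FormalCR

end

theorem proposition2p6 (n : ℕ) (hn : 1 ≤ n)
    (M M' : FormalCR.FormalHypersurface (n + 1)) (hM : M.InClassC)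
    (H : FormalCR.FormalMap (n + 1)) (hH : FormalCR.SendsInto H M M')
    (c : FormalCR.NormalCoordinates M) (c' : FormalCR.NormalCoordinates M') :
    (FormalCR.CRTransversal H M' → c.NotTotallyDegenerate c' H) ∧
    ((M'.IsFiniteType ∨ ¬ c.TransversallyFlat c' H) →
      (FormalCR.CRTransversal H M' ↔ c.NotTotallyDegenerate c' H)) := by
  obtain ⟨c₀, hc₀⟩ := hM
  have h1 : FormalCR.CRTransversal H M' → c.NotTotallyDegenerate c' H := by
    intro hT
    -- Class `𝒞` is known only in `c₀`. CR-transversality needs no coordinates, so the argument runs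
    -- in `c₀` and its conclusion is transported to `c`.
    refine FormalCR.NormalCoordinates.NotTotallyDegenerate.change_source (c₁ := c₀) ?_ c
    rw [FormalCR.NormalCoordinates.notTotallyDegenerate_iff]
    exact (c₀.isNormalMap c' hH).det_restrictedJacobian_ne_zero hc₀.eq_zero
      ((c₀.crTransversal_iff c' hH).mp hT)
  refine ⟨h1, fun h2 => ⟨h1, fun h3 => ?_⟩⟩
  rw [FormalCR.NormalCoordinates.notTotallyDegenerate_iff] at h3
  rw [c.crTransversal_iff c' hH]
  refine (c.isNormalMap c' hH).constantCoeff_pderiv_last_ne_zero_of_finiteType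
    ((hc₀.finiteType hn).change c) h3 (h2.imp ?_ fun h => h)
  rintro ⟨c₁', hc₁'⟩
  exact hc₁'.change c'
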